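/- For $p\in(0,1)$ let $X_1,X_2,\ldots$ be independent random variables with the geometric distribution $\mathbf P[X_i=j]=p(1-p)^{j-1}$, $j=1,2,\ldots$. Let $\Pi=(\Pi_1,\Pi_2,\ldots)$ be the sequence of distinct values in order of appearance from $(X_1,X_2,\ldots)$, let $K=\inf\{k\ge 1 : \Pi(\{1,\ldots,k\})=\{1,\ldots,k\}\}$ be the size of the first block of $\Pi$, and let $N$ be the minimal number of samples such that $\{X_1,\ldots,X_N\}=\{1,\ldots,K\}$ (with $K=\infty$ or $N=\infty$ if there is no such number). Put $$b=\log 2-\int_0^\infty \log\bigl(1-2^{-e^{y}}\bigr)\,dy .$$ Then $p\log\log N\to b$ in probability as $p\to 0$; that is, for every $\varepsilon>0$, $$\mathbf P\bigl[\,2\le N<\infty \ \text{ and }\ |p\log\log N-b|<\varepsilon\,\bigr]\to 1\qquad\text{as } p\downarrow 0 .$$ -/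

import Mathlib

open MeasureTheory ProbabilityTheory Filter Topology

namespace Rainstick

/-- The samples `X₁, X₂, …` are stored as `x 0, x 1, …`, so `x n` is the sample number `n + 1`.
`IsNew x n` says that the value of that sample has not been seen earlier. -/
def IsNew (x : ℕ → ℕ) (n : ℕ) : Prop := ∀ m < n, x m ≠ x n

/-- The sequence of distinct values of `x` in order of appearance: `perm x i` is the value
`Π_{i+1}` of the biased permutation. If only `d` distinct values occur, then the entries with
`i ≥ d` repeat the first value, which creates no additional block. -/
noncomputable def perm (x : ℕ → ℕ) (i : ℕ) : ℕ := x (Nat.nth (IsNew x) i)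

/-- `IsBlock x k` says that `k ≥ 1` and `Π({1, …, k}) = {1, …, k}`. -/
def IsBlock (x : ℕ → ℕ) (k : ℕ) : Prop :=
  1 ≤ k ∧ perm x '' Set.Iio k = Set.Icc 1 k

/-- The size `K` of the first block (infinite if there is no block). -/
noncomputable def blockSize (x : ℕ → ℕ) : ℕ∞ :=
  ⨅ k ∈ {k : ℕ | IsBlock x k}, (k : ℕ∞)

/-- The minimal number `N` of samples such that `{X₁, …, X_N} = {1, …, K}`
(infinite if there is no such number, in particular if `K` is infinite). -/
noncomputable def numSamples (x : ℕ → ℕ) : ℕ∞ :=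
  ⨅ n ∈ {n : ℕ | x '' Set.Iio n = {j : ℕ | 1 ≤ j ∧ (j : ℕ∞) ≤ blockSize x}}, (n : ℕ∞)

/-- The constant `b = log 2 - ∫₀^∞ log (1 - 2^{-e^y}) dy`. -/
noncomputable def b : ℝ :=
  Real.log 2 - ∫ y in Set.Ioi (0 : ℝ), Real.log (1 - (2 : ℝ) ^ (-Real.exp y))

end Rainstick

/-! Write `q = 1 - p`, and let `u k = renewal p k` be the probability that some initial segment of
the samples has value set `{1, …, k}`. This happens iff all of `1, …, k` appear before the first
sample outside `{1, …, k}`. Inclusion-exclusion, equivalently Poissonization, turns this probability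
into a Laplace integral (`tsum_exitsAt`).

Put `λ = -log q` and substitute `p r = log 2 * e ^ s`. The integrand becomes the exponential of
minus a Riemann sum, and its exponent is about `-(log 2 * e ^ s + ∫_s^∞ logLoss) / p`. The bracket
is smallest at `s = 0`, with value `b`. Hence `u k = exp (-(b + o(1)) / p)` once `p k` is large
(`le_renewal`, `exists_renewal_le`).

The process regenerates after its first block, so `u` is bounded by the convolution of the law of
`K` with `u` (`renewal_le_sum`). Summation gives `P(K > m) ≤ 1 / (1 + u 1 + ⋯ + u m)`, and the union
bound gives `P(K < m) ≤ ∑_{k < m} u k`. So `p log K` is close to `b`. Finally, seeing a value `m`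
takes about `q ^ (-m)` samples, and a block inside `{1, …, m}` must be complete before a larger
value appears. Thus `log N` is comparable to `p K` up to factors that vanish in `p log log N`;
`one_le_measure_add` collects the exceptional events. -/

namespace Rainstick

/-! ### Blocks of the permutation in terms of value sets of initial samples. -/

/-- The first `n` samples are the first ones whose set of values is of the form `{1, …, i}` with
`i ≥ 1`, and this set is `{1, …, j}`. -/
def IsFirstBlock (x : ℕ → ℕ) (n j : ℕ) : Prop :=
  1 ≤ j ∧ x '' Set.Iio n = Set.Icc 1 j ∧ ∀ m < n, ∀ i, 1 ≤ i → x '' Set.Iio m ≠ Set.Icc 1 i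

lemma exists_isNew (x : ℕ → ℕ) (m : ℕ) : ∃ m' ≤ m, IsNew x m' ∧ x m' = x m := by
  classical
  have hex : ∃ i, x i = x m := ⟨m, rfl⟩
  refine ⟨Nat.find hex, Nat.find_min' hex rfl, fun i hi hxi => ?_, Nat.find_spec hex⟩
  exact Nat.find_min hex hi (hxi.trans (Nat.find_spec hex))

lemma image_isNew (x : ℕ → ℕ) (n : ℕ) :
    x '' {m | m < n ∧ IsNew x m} = x '' Set.Iio n := by
  apply Set.Subset.antisymm
  · exact Set.image_mono fun m hm => hm.1
  · rintro _ ⟨m, hm, rfl⟩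
    obtain ⟨m', hm', hnew, hx⟩ := exists_isNew x m
    exact ⟨m', ⟨lt_of_le_of_lt hm' hm, hnew⟩, hx⟩

lemma injOn_isNew (x : ℕ → ℕ) : Set.InjOn x {m | IsNew x m} := by
  intro a ha c hc h
  rcases lt_trichotomy a c with hlt | heq | hlt
  · exact absurd h (hc a hlt)
  · exact heq
  · exact absurd h.symm (ha c hlt)

lemma Icc_one_injective {i j : ℕ} (h : Set.Icc 1 i = Set.Icc 1 j) : i = j := by
  have := congrArg Set.ncard h
  simpa [Set.ncard_eq_toFinset_card'] using this

lemma nth_isNew_image (x : ℕ → ℕ) (n : ℕ) [DecidablePred (IsNew x)] :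
    Nat.nth (IsNew x) '' Set.Iio (Nat.count (IsNew x) n) = {m | m < n ∧ IsNew x m} := by
  ext m
  constructor
  · rintro ⟨i, hi, rfl⟩
    exact ⟨Nat.nth_lt_of_lt_count hi, Nat.nth_mem i fun hf =>
      Nat.lt_of_lt_of_le hi (Nat.count_le_card hf n)⟩
  · rintro ⟨hm, hnew⟩
    exact ⟨Nat.count (IsNew x) m, Nat.count_strict_mono hnew hm, Nat.nth_count hnew⟩

/-- Discarding repeated samples does not change the set of values seen so far. From here on the
permutation is replaced by the growing sets `x '' Set.Iio n`. -/
lemma isBlock_iff (x : ℕ → ℕ) (k : ℕ) :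
    IsBlock x k ↔ 1 ≤ k ∧ ∃ n, x '' Set.Iio n = Set.Icc 1 k := by
  classical
  unfold IsBlock
  refine and_congr_right fun hk => ⟨fun h => ?_, ?_⟩
  · have hfin : (Nat.nth (IsNew x) '' Set.Iio k).Finite := (Set.finite_Iio k).image _
    obtain ⟨M, hM⟩ := hfin.bddAbove
    have hex : ∃ n, ∀ i < k, Nat.nth (IsNew x) i < n :=
      ⟨M + 1, fun i hi => Nat.lt_succ_of_le (hM ⟨i, hi, rfl⟩)⟩
    refine ⟨Nat.find hex, ?_⟩
    rw [← h]
    apply Set.Subset.antisymm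
    · rw [← image_isNew]
      rintro _ ⟨m, ⟨hm, hnew⟩, rfl⟩
      have := Nat.find_min hex hm
      push Not at this
      obtain ⟨i, hi, hmi⟩ := this
      have hcount : Nat.count (IsNew x) m < k := by
        by_cases hn : ∀ hf : (Set.ofPred (IsNew x)).Finite, i < hf.toFinset.card
        · calc Nat.count (IsNew x) m ≤ Nat.count (IsNew x) (Nat.nth (IsNew x) i) :=
                Nat.count_monotone _ hmi
            _ = i := Nat.count_nth hn
            _ < k := hi
        -- There are at most `i` new indices, so `Nat.nth` takes its default value 0 and `m = 0`.
        · push Not at hn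
          obtain ⟨hf, hc⟩ := hn
          rw [Nat.nth_of_card_le hf hc] at hmi
          obtain rfl : m = 0 := by omega
          simpa using Nat.lt_of_succ_le hk
      exact ⟨Nat.count (IsNew x) m, hcount, by simp [perm, Nat.nth_count hnew]⟩
    · rintro _ ⟨i, hi, rfl⟩
      exact ⟨_, Nat.find_spec hex i hi, rfl⟩
  · rintro ⟨n, hn⟩
    have hcard : Nat.count (IsNew x) n = k := by
      have h1 : (x '' {m | m < n ∧ IsNew x m}).ncard = k := by
        rw [image_isNew, hn]; simp [Set.ncard_eq_toFinset_card']
      rw [((injOn_isNew x).mono fun m hm => hm.2).ncard_image] at h1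
      rw [← h1, Nat.count_eq_card_filter_range, ← Set.ncard_coe_finset]
      congr 1
      ext m; simp
    have : perm x '' Set.Iio k = x '' (Nat.nth (IsNew x) '' Set.Iio k) := by
      rw [Set.image_image]; rfl
    rw [this, ← hcard, nth_isNew_image, image_isNew, hn, hcard]

lemma IsFirstBlock.blockSize_eq {x : ℕ → ℕ} {n j : ℕ} (h : IsFirstBlock x n j) :
    blockSize x = j := by
  obtain ⟨hj, hn, hmin⟩ := h
  apply le_antisymm
  · exact iInf₂_le j ((isBlock_iff x j).2 ⟨hj, n, hn⟩)
  · refine le_iInf₂ fun k hk => ?_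
    obtain ⟨hk1, m, hm⟩ := (isBlock_iff x k).1 hk
    have hnm : n ≤ m := by
      by_contra hlt
      exact hmin m (not_le.1 hlt) k hk1 hm
    have hsub : Set.Icc 1 j ⊆ Set.Icc 1 k := by
      rw [← hn, ← hm]; exact Set.image_mono (Set.Iio_subset_Iio hnm)
    exact_mod_cast (hsub ⟨hj, le_rfl⟩).2

lemma IsFirstBlock.numSamples_eq {x : ℕ → ℕ} {n j : ℕ} (h : IsFirstBlock x n j) :
    numSamples x = n := by
  have hset : {i : ℕ | 1 ≤ i ∧ (i : ℕ∞) ≤ blockSize x} = Set.Icc 1 j := by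
    ext i; simp [h.blockSize_eq]
  obtain ⟨hj, hn, hmin⟩ := h
  unfold numSamples
  rw [hset]
  apply le_antisymm
  · exact iInf₂_le n hn
  · refine le_iInf₂ fun m hm => ?_
    have hnm : n ≤ m := by
      by_contra hlt
      exact hmin m (not_le.1 hlt) j hj hm
    exact_mod_cast hnm

lemma exists_isFirstBlock {x : ℕ → ℕ} {m k : ℕ} (hk : 1 ≤ k) (h : x '' Set.Iio m = Set.Icc 1 k) :
    ∃ n ≤ m, ∃ j ≤ k, IsFirstBlock x n j := by
  classical
  have hex : ∃ n i, 1 ≤ i ∧ x '' Set.Iio n = Set.Icc 1 i := ⟨m, k, hk, h⟩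
  obtain ⟨j, hj, hn⟩ := Nat.find_spec hex
  have hle : Nat.find hex ≤ m := Nat.find_min' hex ⟨k, hk, h⟩
  refine ⟨Nat.find hex, hle, j, ?_, hj, hn, fun l hl i hi hli => Nat.find_min hex hl ⟨i, hi, hli⟩⟩
  have hsub : Set.Icc 1 j ⊆ Set.Icc 1 k := by
    rw [← hn, ← h]; exact Set.image_mono (Set.Iio_subset_Iio hle)
  exact (hsub ⟨hj, le_rfl⟩).2

lemma IsFirstBlock.unique {x : ℕ → ℕ} {n j n' j' : ℕ} (h : IsFirstBlock x n j)
    (h' : IsFirstBlock x n' j') : n = n' ∧ j = j' := by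
  have hn : n = n' := by
    rcases lt_trichotomy n n' with hlt | heq | hlt
    · exact absurd h.2.1 (h'.2.2 n hlt j h.1)
    · exact heq
    · exact absurd h'.2.1 (h.2.2 n' hlt j' h'.1)
  subst hn
  exact ⟨rfl, Icc_one_injective (h.2.1.symm.trans h'.2.1)⟩

/-! ### The function `logLoss` and `b` as a minimum. -/

/-- The negative of the integrand of `b`. -/
noncomputable def logLoss (y : ℝ) : ℝ := -Real.log (1 - (2 : ℝ) ^ (-Real.exp y))

lemma log_two_pos : 0 < Real.log 2 := Real.log_pos one_lt_two

lemma logLoss_eq (y : ℝ) :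
    logLoss y = -Real.log (1 - Real.exp (-(Real.log 2 * Real.exp y))) := by
  rw [logLoss, Real.rpow_def_of_pos two_pos, mul_neg]

lemma one_sub_exp_neg_pos {x : ℝ} (hx : 0 < x) : 0 < 1 - Real.exp (-x) := by
  have : Real.exp (-x) < 1 := by simpa using hx
  linarith

lemma log_two_mul_exp_pos (y : ℝ) : 0 < Real.log 2 * Real.exp y :=
  mul_pos log_two_pos (Real.exp_pos y)

lemma exp_neg_logLoss (y : ℝ) :
    Real.exp (-logLoss y) = 1 - Real.exp (-(Real.log 2 * Real.exp y)) := by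
  rw [logLoss_eq, neg_neg, Real.exp_log (one_sub_exp_neg_pos (log_two_mul_exp_pos y))]

lemma logLoss_antitone : Antitone logLoss := by
  intro a c hac
  rw [logLoss_eq, logLoss_eq]
  have h1 := one_sub_exp_neg_pos (log_two_mul_exp_pos a)
  have h2 : Real.log 2 * Real.exp a ≤ Real.log 2 * Real.exp c :=
    mul_le_mul_of_nonneg_left (Real.exp_le_exp.2 hac) log_two_pos.le
  have h3 := Real.exp_le_exp.2 (neg_le_neg h2)
  have := Real.log_le_log h1 (sub_le_sub_left h3 1)
  linarith

lemma logLoss_nonneg (y : ℝ) : 0 ≤ logLoss y := by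
  rw [logLoss_eq]
  have h1 := one_sub_exp_neg_pos (log_two_mul_exp_pos y)
  have := Real.log_nonpos h1.le (by linarith [Real.exp_pos (-(Real.log 2 * Real.exp y))])
  linarith

/-- This makes `s = 0` the critical point of `log 2 * e ^ s + ∫_s^t logLoss`, whose derivative is
`log 2 * e ^ s - logLoss s`. -/
lemma logLoss_zero : logLoss 0 = Real.log 2 := by
  rw [logLoss_eq, Real.exp_zero, mul_one, Real.exp_neg, Real.exp_log two_pos, ← Real.log_inv]
  norm_num

/-- Both sides are separated by `1 / (e ^ x - 1)`. The bound supplies the exponential tail of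
`logLoss`. -/
lemma neg_log_one_sub_exp_neg_le {x : ℝ} (hx : 0 < x) :
    -Real.log (1 - Real.exp (-x)) ≤ x⁻¹ := by
  have h1 := one_sub_exp_neg_pos hx
  have h2 := Real.one_sub_inv_le_log_of_pos h1
  have h3 : x * (1 - Real.exp (-x))⁻¹ ≤ 1 + x := by
    rw [← div_eq_mul_inv, div_le_iff₀ h1]
    have h4 : (1 + x) * Real.exp (-x) ≤ 1 := by
      rw [Real.exp_neg, ← div_eq_mul_inv, div_le_one (Real.exp_pos x)]
      linarith [Real.add_one_le_exp x]
    nlinarith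
  rw [← one_div, le_div_iff₀ hx]
  nlinarith

lemma logLoss_le (y : ℝ) : logLoss y ≤ (Real.log 2)⁻¹ * Real.exp (-y) := by
  rw [logLoss_eq, Real.exp_neg y, ← mul_inv]
  exact neg_log_one_sub_exp_neg_le (log_two_mul_exp_pos y)

lemma logLoss_integrableOn (s : ℝ) : IntegrableOn logLoss (Set.Ioi s) := by
  have hg : IntegrableOn (fun y : ℝ => (Real.log 2)⁻¹ * Real.exp (-y)) (Set.Ioi s) :=
    (integrableOn_exp_neg_Ioi s).const_mul _
  refine hg.mono' logLoss_antitone.measurable.aestronglyMeasurable ?_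
  refine ae_of_all _ fun y => ?_
  rw [Real.norm_of_nonneg (logLoss_nonneg y)]
  exact logLoss_le y

lemma logLoss_intervalIntegrable (s t : ℝ) : IntervalIntegrable logLoss volume s t :=
  logLoss_antitone.intervalIntegrable

lemma b_eq : b = Real.log 2 + ∫ y in Set.Ioi (0 : ℝ), logLoss y := by
  simp only [b, logLoss, integral_neg, sub_eq_add_neg]

lemma integral_logLoss_le {t : ℝ} (ht : 0 ≤ t) : ∫ y in (0 : ℝ)..t, logLoss y ≤ b - Real.log 2 := by
  rw [b_eq, intervalIntegral.integral_of_le ht, add_sub_cancel_left]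
  exact setIntegral_mono_set (logLoss_integrableOn 0) (ae_of_all _ logLoss_nonneg)
    Set.Ioc_subset_Ioi_self.eventuallyLE

lemma log_two_le_b : Real.log 2 ≤ b := by
  have := integral_logLoss_le le_rfl
  simp at this; exact this

lemma b_pos : 0 < b := log_two_pos.trans_le log_two_le_b

lemma tendsto_integral_logLoss :
    Tendsto (fun t => ∫ y in (0 : ℝ)..t, logLoss y) atTop (𝓝 (b - Real.log 2)) := by
  rw [b_eq, add_sub_cancel_left]
  exact intervalIntegral_tendsto_integral_Ioi 0 (logLoss_integrableOn 0) tendsto_id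

/-- `log 2 * e ^ s + ∫_s^t logLoss` is smallest at `s = 0`. -/
lemma log_two_add_integral_le (s t : ℝ) :
    Real.log 2 + ∫ y in (0 : ℝ)..t, logLoss y ≤
      Real.log 2 * Real.exp s + ∫ y in s..t, logLoss y := by
  have hsplit : ∫ y in (0 : ℝ)..t, logLoss y = (∫ y in (0 : ℝ)..s, logLoss y) +
      ∫ y in s..t, logLoss y :=
    (intervalIntegral.integral_add_adjacent_intervals (logLoss_intervalIntegrable _ _)
      (logLoss_intervalIntegrable _ _)).symm
  -- `logLoss` decreases through the value `log 2` at 0, so this holds for both signs of `s`;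
  -- combined with `1 + s ≤ e ^ s` it replaces differentiation.
  have hle : ∫ y in (0 : ℝ)..s, logLoss y ≤ Real.log 2 * s := by
    rcases le_total 0 s with hs | hs
    · have := intervalIntegral.integral_mono_on hs (logLoss_intervalIntegrable 0 s)
        (intervalIntegrable_const (c := Real.log 2))
        (fun y hy => (logLoss_antitone hy.1).trans logLoss_zero.le)
      simpa [mul_comm] using this
    · have := intervalIntegral.integral_mono_on hs (intervalIntegrable_const (c := Real.log 2))
        (logLoss_intervalIntegrable s 0)
        (fun y hy => logLoss_zero.ge.trans (logLoss_antitone hy.2))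
      rw [intervalIntegral.integral_symm]
      simp at this
      linarith
  have hexp : Real.log 2 * (s + 1) ≤ Real.log 2 * Real.exp s :=
    mul_le_mul_of_nonneg_left (Real.add_one_le_exp s) log_two_pos.le
  linarith

lemma integral_comp_affine (s : ℝ) {lam : ℝ} (hl : 0 < lam) (u v : ℝ) :
    ∫ y in u..v, logLoss (s + lam * y) = lam⁻¹ * ∫ y in (s + lam * u)..(s + lam * v), logLoss y := by
  have := intervalIntegral.integral_comp_add_mul (a := u) (b := v) logLoss hl.ne' s
  simpa using this

lemma sum_logLoss_le (s : ℝ) {lam : ℝ} (hl : 0 < lam) (k : ℕ) :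
    ∑ i ∈ Finset.range k, logLoss (s + lam * (i + 1 : ℕ)) ≤
      lam⁻¹ * ∫ y in s..(s + lam * k), logLoss y := by
  have hanti : AntitoneOn (fun y => logLoss (s + lam * y)) (Set.Icc (0 : ℝ) (0 + k)) :=
    fun a _ c _ hac => logLoss_antitone (by
      have := mul_le_mul_of_nonneg_left hac hl.le
      linarith)
  have h := hanti.sum_le_integral
  rw [integral_comp_affine s hl] at h
  simpa using h

lemma le_sum_logLoss (s : ℝ) {lam : ℝ} (hl : 0 < lam) (k : ℕ) :
    lam⁻¹ * ∫ y in (s + lam)..(s + lam * (1 + k)), logLoss y ≤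
      ∑ i ∈ Finset.range k, logLoss (s + lam * (i + 1 : ℕ)) := by
  have hanti : AntitoneOn (fun y => logLoss (s + lam * y)) (Set.Icc (1 : ℝ) (1 + k)) :=
    fun a _ c _ hac => logLoss_antitone (by
      have := mul_le_mul_of_nonneg_left hac hl.le
      linarith)
  have h := hanti.integral_le_sum
  rw [integral_comp_affine s hl] at h
  simpa [add_comm] using h

/-- The truncated exponent is bounded below by almost `b`, uniformly in `s`. -/
lemma exists_le_log_two_mul_exp_add_integral {ε : ℝ} (hε : 0 < ε) :
    ∃ C > 0, ∃ η > 0, ∀ lam, 0 ≤ lam → lam ≤ η → ∀ s t, s + C ≤ t →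
      b - ε ≤ Real.log 2 * Real.exp s + ∫ y in (s + lam)..t, logLoss y := by
  -- Left of `-M` the term `log 2 * e ^ s` is negligible; cutting the integral at `T` loses at most
  -- `ε / 3`.
  obtain ⟨M, hM⟩ : ∃ M : ℝ, Real.log 2 * Real.exp (-M) ≤ ε / 3 := by
    have : Tendsto (fun M : ℝ => Real.log 2 * Real.exp (-M)) atTop (𝓝 (Real.log 2 * 0)) :=
      Real.tendsto_exp_neg_atTop_nhds_zero.const_mul _
    rw [mul_zero] at this
    exact ((tendsto_order.1 this).2 (ε / 3) (by positivity)).exists.imp fun _ h => h.le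
  obtain ⟨T, hT⟩ : ∃ T : ℝ, b - Real.log 2 - ε / 3 ≤ ∫ y in (0 : ℝ)..T, logLoss y :=
    ((tendsto_order.1 tendsto_integral_logLoss).1 (b - Real.log 2 - ε / 3)
      (by linarith)).exists.imp fun _ h => h.le
  -- `logLoss` is unbounded at `-∞`, so the loss from the shift by `lam` is controlled only on `[-M,
  -- ∞)`.
  set c := logLoss (-M) + 1 with hc
  have hcpos : 0 < c := by have := logLoss_nonneg (-M); linarith
  have hη : 0 < ε / 3 / c := by positivity
  -- the case of large `s`
  have key : ∀ lam, 0 ≤ lam → lam ≤ ε / 3 / c → ∀ s t, -M ≤ s → T ≤ t →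
      b - 2 * (ε / 3) ≤ Real.log 2 * Real.exp s + ∫ y in (s + lam)..t, logLoss y := by
    intro lam h0 h1 s t hs ht
    have e1 := log_two_add_integral_le s t
    have e2 : (∫ y in (0 : ℝ)..T, logLoss y) ≤ ∫ y in (0 : ℝ)..t, logLoss y := by
      rw [← intervalIntegral.integral_add_adjacent_intervals (logLoss_intervalIntegrable 0 T)
        (logLoss_intervalIntegrable T t)]
      have := intervalIntegral.integral_nonneg (μ := volume) ht fun y _ => logLoss_nonneg y
      linarith
    have e3 := intervalIntegral.integral_add_adjacent_intervals
      (logLoss_intervalIntegrable s (s + lam)) (logLoss_intervalIntegrable (s + lam) t)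
    have e4 : ∫ y in s..(s + lam), logLoss y ≤ lam * c := by
      have := intervalIntegral.integral_mono_on (by linarith : s ≤ s + lam)
        (logLoss_intervalIntegrable s (s + lam)) (intervalIntegrable_const (c := c))
        (fun y hy => by
          have := logLoss_antitone (hs.trans hy.1)
          linarith)
      simpa using this
    have e5 : lam * c ≤ ε / 3 := by rwa [le_div_iff₀ hcpos] at h1
    linarith
  -- A window of length `T + M` starting at or after `-M` reaches `T`; the two 1's ensure `s + lam ≤
  -- t`.
  refine ⟨max 1 (T + M), by positivity, min 1 (ε / 3 / c), by positivity,
    fun lam h0 h1' s t hst => ?_⟩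
  have h1 := h1'.trans (min_le_right _ _)
  have h2 := h1'.trans (min_le_left _ _)
  have hC := le_max_right 1 (T + M)
  have hC1 := le_max_left 1 (T + M)
  rcases le_total (-M) s with hs | hs
  · have := key lam h0 h1 s t hs (by linarith)
    linarith
  · -- translate the interval to the right
    have e1 := key lam h0 h1 (-M) (t - s - M) le_rfl (by linarith)
    have e2 : ∫ y in (-M + lam)..(t - s - M), logLoss y =
        ∫ y in (s + lam)..t, logLoss (y + (-M - s)) := by
      rw [intervalIntegral.integral_comp_add_right]
      congr 1 <;> ring
    have e3 : ∫ y in (s + lam)..t, logLoss (y + (-M - s)) ≤ ∫ y in (s + lam)..t, logLoss y := by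
      refine intervalIntegral.integral_mono_on (by linarith) ?_ (logLoss_intervalIntegrable _ _)
        fun y _ => logLoss_antitone (by linarith)
      exact Antitone.intervalIntegrable fun a c hac => logLoss_antitone (by linarith)
    have := log_two_mul_exp_pos s
    linarith

/-! ### The Laplace integral of the renewal probabilities and its estimates. -/

/-- The probability that there is a block of size `k`, as the Laplace transform of an
inclusion-exclusion sum. -/
noncomputable def renewal (p : ℝ) (k : ℕ) : ℝ :=
  ∫ r in Set.Ioi (0 : ℝ),
    Real.exp (-r) * ∏ l ∈ Finset.range k, (1 - Real.exp (-(p * (1 - p)⁻¹ ^ (l + 1) * r)))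

lemma renewal_zero (p : ℝ) : renewal p 0 = 1 := by
  simp only [renewal, Finset.range_zero, Finset.prod_empty, mul_one]
  exact integral_exp_neg_Ioi_zero

section Bounds

variable {p : ℝ}

lemma coeff_pos (hp : 0 < p) (hp1 : p < 1) (l : ℕ) : 0 < p * (1 - p)⁻¹ ^ (l + 1) := by
  have : 0 < 1 - p := by linarith
  positivity

lemma factor_nonneg (hp : 0 < p) (hp1 : p < 1) (l : ℕ) {r : ℝ} (hr : 0 ≤ r) :
    0 ≤ 1 - Real.exp (-(p * (1 - p)⁻¹ ^ (l + 1) * r)) := by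
  have : Real.exp (-(p * (1 - p)⁻¹ ^ (l + 1) * r)) ≤ 1 :=
    Real.exp_le_one_iff.2 (by have := mul_nonneg (coeff_pos hp hp1 l).le hr; linarith)
  linarith

lemma factor_le_one (l : ℕ) (r : ℝ) :
    1 - Real.exp (-(p * (1 - p)⁻¹ ^ (l + 1) * r)) ≤ 1 := by
  linarith [Real.exp_pos (-(p * (1 - p)⁻¹ ^ (l + 1) * r))]

lemma integrand_nonneg (hp : 0 < p) (hp1 : p < 1) (k : ℕ) {r : ℝ} (hr : 0 ≤ r) :
    0 ≤ Real.exp (-r) * ∏ l ∈ Finset.range k, (1 - Real.exp (-(p * (1 - p)⁻¹ ^ (l + 1) * r))) :=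
  mul_nonneg (Real.exp_pos _).le (Finset.prod_nonneg fun l _ => factor_nonneg hp hp1 l hr)

lemma renewal_integrableOn (hp : 0 < p) (hp1 : p < 1) (k : ℕ) :
    IntegrableOn (fun r => Real.exp (-r) *
      ∏ l ∈ Finset.range k, (1 - Real.exp (-(p * (1 - p)⁻¹ ^ (l + 1) * r)))) (Set.Ioi 0) := by
  refine (integrableOn_exp_neg_Ioi 0).mono' (Continuous.aestronglyMeasurable (by fun_prop)) ?_
  refine ae_restrict_of_forall_mem measurableSet_Ioi fun r (hr : 0 < r) => ?_
  rw [Real.norm_of_nonneg (integrand_nonneg hp hp1 k hr.le)]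
  exact mul_le_of_le_one_right (Real.exp_pos _).le
    (Finset.prod_le_one (fun l _ => factor_nonneg hp hp1 l hr.le) fun l _ => factor_le_one l r)

lemma renewal_nonneg (hp : 0 < p) (hp1 : p < 1) (k : ℕ) : 0 ≤ renewal p k :=
  setIntegral_nonneg measurableSet_Ioi fun _ hr => integrand_nonneg hp hp1 k (le_of_lt hr)

lemma renewal_antitone (hp : 0 < p) (hp1 : p < 1) : Antitone (renewal p) := by
  refine antitone_nat_of_succ_le fun k => ?_
  refine setIntegral_mono_on (renewal_integrableOn hp hp1 _) (renewal_integrableOn hp hp1 _)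
    measurableSet_Ioi fun r (hr : 0 < r) => ?_
  rw [Finset.prod_range_succ, ← mul_assoc]
  exact mul_le_of_le_one_right (integrand_nonneg hp hp1 k hr.le) (factor_le_one k r)

lemma lam_pos (hp : 0 < p) (hp1 : p < 1) : 0 < -Real.log (1 - p) := by
  have := Real.log_neg (by linarith : 0 < 1 - p) (by linarith)
  linarith

lemma le_lam (hp1 : p < 1) : p ≤ -Real.log (1 - p) := by
  have := Real.log_le_sub_one_of_pos (by linarith : 0 < 1 - p)
  linarith

lemma lam_inv_le (hp : 0 < p) (hp1 : p < 1) : (-Real.log (1 - p))⁻¹ ≤ p⁻¹ :=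
  inv_anti₀ hp (le_lam hp1)

lemma lam_le (hp1 : p < 1) : -Real.log (1 - p) ≤ p / (1 - p) := by
  have hq : 0 < 1 - p := by linarith
  have := Real.one_sub_inv_le_log_of_pos hq
  have h2 : p / (1 - p) = (1 - p)⁻¹ - 1 := by field_simp; ring
  linarith

lemma le_lam_inv (hp : 0 < p) (hp1 : p < 1) : (1 - p) / p ≤ (-Real.log (1 - p))⁻¹ := by
  have hq : 0 < 1 - p := by linarith
  rw [← inv_div]
  exact inv_anti₀ (lam_pos hp hp1) (lam_le hp1)

/-- The powers of `(1 - p)⁻¹` are exponentials of multiples of `λ = -log (1 - p)`, so the factors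
become translates of one function and the product a Riemann sum of mesh `λ`. -/
lemma prod_eq_exp (hp1 : p < 1) {r s : ℝ}
    (hrs : p * r = Real.log 2 * Real.exp s) (k : ℕ) :
    ∏ l ∈ Finset.range k, (1 - Real.exp (-(p * (1 - p)⁻¹ ^ (l + 1) * r))) =
      Real.exp (-∑ l ∈ Finset.range k, logLoss (s + -Real.log (1 - p) * (l + 1 : ℕ))) := by
  have hq : 0 < 1 - p := by linarith
  rw [← Finset.sum_neg_distrib, Real.exp_sum]
  refine Finset.prod_congr rfl fun l _ => ?_
  have h1 : Real.exp (-Real.log (1 - p) * (l + 1 : ℕ)) = (1 - p)⁻¹ ^ (l + 1) := by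
    rw [mul_comm, Real.exp_nat_mul, Real.exp_neg, Real.exp_log hq]
  rw [exp_neg_logLoss, Real.exp_add, h1, ← mul_assoc, ← hrs]
  congr 3
  ring

/-- Laplace's method from below: only a unit interval to the right of `r₀ = log 2 / p`, the point of
the minimiser `s = 0`, is kept. -/
lemma le_renewal (hp : 0 < p) (hp1 : p < 1) (k : ℕ) :
    Real.exp (-1) * Real.exp (-(b / p)) ≤ renewal p k := by
  have hq : 0 < 1 - p := by linarith
  set r₀ := Real.log 2 / p with hr₀
  have hr₀pos : 0 < r₀ := div_pos log_two_pos hp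
  have hlow : ∀ r ∈ Set.Ioc r₀ (r₀ + 1), Real.exp (-1) * Real.exp (-(b / p)) ≤
      Real.exp (-r) * ∏ l ∈ Finset.range k, (1 - Real.exp (-(p * (1 - p)⁻¹ ^ (l + 1) * r))) := by
    rintro r ⟨hr, hr'⟩
    have h1 : ∏ l ∈ Finset.range k, (1 - Real.exp (-(p * (1 - p)⁻¹ ^ (l + 1) * r₀))) ≤
        ∏ l ∈ Finset.range k, (1 - Real.exp (-(p * (1 - p)⁻¹ ^ (l + 1) * r))) := by
      refine Finset.prod_le_prod (fun l _ => factor_nonneg hp hp1 l hr₀pos.le) fun l _ => ?_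
      have := mul_le_mul_of_nonneg_left hr.le (coeff_pos hp hp1 l).le
      have := Real.exp_le_exp.2 (neg_le_neg this)
      linarith
    rw [prod_eq_exp hp1 (s := 0) (by rw [hr₀]; field_simp; simp)] at h1
    have h2 := sum_logLoss_le 0 (lam_pos hp hp1) k
    have h3 := integral_logLoss_le
      (by have := lam_pos hp hp1; positivity : 0 ≤ 0 + -Real.log (1 - p) * (k : ℝ))
    have h4 : (-Real.log (1 - p))⁻¹ * ∫ y in (0 : ℝ)..(0 + -Real.log (1 - p) * (k : ℝ)), logLoss y ≤
        p⁻¹ * (b - Real.log 2) :=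
      mul_le_mul (lam_inv_le hp hp1) h3
        (intervalIntegral.integral_nonneg (by have := lam_pos hp hp1; positivity)
          fun y _ => logLoss_nonneg y) (by positivity)
    refine le_trans ?_ (mul_le_mul_of_nonneg_left h1 (Real.exp_pos _).le)
    rw [← Real.exp_add, ← Real.exp_add]
    apply Real.exp_le_exp.2
    have h5 : b / p = p⁻¹ * (b - Real.log 2) + r₀ := by rw [hr₀]; field_simp; ring
    linarith
  calc Real.exp (-1) * Real.exp (-(b / p))
      = ∫ _ in Set.Ioc r₀ (r₀ + 1), Real.exp (-1) * Real.exp (-(b / p)) := by simp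
    _ ≤ ∫ r in Set.Ioc r₀ (r₀ + 1), Real.exp (-r) *
        ∏ l ∈ Finset.range k, (1 - Real.exp (-(p * (1 - p)⁻¹ ^ (l + 1) * r))) := by
        refine setIntegral_mono_on (integrableOn_const (by simp)) ?_ measurableSet_Ioc hlow
        exact (renewal_integrableOn hp hp1 k).mono_set fun r hr => hr₀pos.trans hr.1
    _ ≤ renewal p k := by
        refine setIntegral_mono_set (renewal_integrableOn hp hp1 k) ?_
          (LE.le.eventuallyLE fun r hr => hr₀pos.trans hr.1)
        exact ae_restrict_of_forall_mem measurableSet_Ioi fun r hr =>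
          integrand_nonneg hp hp1 k (le_of_lt hr)

/-- Laplace's method from above: a fraction `δ` of the exponent keeps the integral over `r` finite,
and the rest is bounded by its minimum. -/
lemma renewal_le_of_forall (hp : 0 < p) (hp1 : p < 1) {k : ℕ} {δ m : ℝ} (hδ : 0 < δ) (hδ1 : δ ≤ 1)
    (h : ∀ s : ℝ, m ≤ Real.log 2 * Real.exp s / p +
      ∑ l ∈ Finset.range k, logLoss (s + -Real.log (1 - p) * (l + 1 : ℕ))) :
    renewal p k ≤ δ⁻¹ * Real.exp (-((1 - δ) * m)) := by
  have hint : ∫ r in Set.Ioi (0 : ℝ), Real.exp (-δ * r) * Real.exp (-((1 - δ) * m)) =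
      δ⁻¹ * Real.exp (-((1 - δ) * m)) := by
    rw [integral_mul_const, integral_exp_mul_Ioi (by linarith)]
    simp
  rw [← hint]
  refine setIntegral_mono_on (renewal_integrableOn hp hp1 k) ?_ measurableSet_Ioi
    fun r (hr : 0 < r) => ?_
  · exact (integrableOn_exp_mul_Ioi (by linarith) 0).mul_const _
  · have hpr : 0 < p * r / Real.log 2 := div_pos (mul_pos hp hr) log_two_pos
    have hrs : p * r = Real.log 2 * Real.exp (Real.log (p * r / Real.log 2)) := by
      rw [Real.exp_log hpr]
      field_simp [log_two_pos.ne']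
    have h1 := h (Real.log (p * r / Real.log 2))
    rw [prod_eq_exp hp1 hrs, ← Real.exp_add, ← Real.exp_add]
    apply Real.exp_le_exp.2
    rw [← hrs, mul_div_cancel_left₀ _ hp.ne'] at h1
    set S := ∑ l ∈ Finset.range k,
      logLoss (Real.log (p * r / Real.log 2) + -Real.log (1 - p) * (l + 1 : ℕ)) with hS
    have hS0 : 0 ≤ S := Finset.sum_nonneg fun l _ => logLoss_nonneg _
    have h2 := mul_le_mul_of_nonneg_left h1 (by linarith : 0 ≤ 1 - δ)
    nlinarith

/-- Uniform upper bound for the renewal probabilities, except at sizes of order `1 / p`. -/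
lemma exists_renewal_le {ε δ : ℝ} (hε : 0 < ε) (hδ : 0 < δ) (hδ1 : δ ≤ 1) :
    ∃ C : ℝ, 0 < C ∧ ∃ η : ℝ, 0 < η ∧ ∀ p : ℝ, 0 < p → p < 1 → p / (1 - p) ≤ η → ∀ k : ℕ, C ≤ p * k →
      renewal p k ≤ δ⁻¹ * Real.exp (-((1 - δ) * ((1 - p) / p * (b - ε)))) := by
  obtain ⟨C, hC, η, hη, H⟩ := exists_le_log_two_mul_exp_add_integral hε
  refine ⟨C, hC, η, hη, fun p hp hp1 hpη k hk => renewal_le_of_forall hp hp1 hδ hδ1 fun s => ?_⟩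
  have hl := lam_pos hp hp1
  have hlp := le_lam hp1
  have h1 := le_sum_logLoss s hl k
  have h3 : p * k ≤ -Real.log (1 - p) * k := mul_le_mul_of_nonneg_right hlp (Nat.cast_nonneg k)
  have h2 := H (-Real.log (1 - p)) hl.le ((lam_le hp1).trans hpη) s
    (s + -Real.log (1 - p) * (1 + k)) (by linarith)
  have h4 : 0 ≤ ∫ y in (s + -Real.log (1 - p))..(s + -Real.log (1 - p) * (1 + k)), logLoss y :=
    intervalIntegral.integral_nonneg (by nlinarith [mul_nonneg hl.le (Nat.cast_nonneg (α := ℝ) k)])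
      fun y _ => logLoss_nonneg y
  -- The factor `(1 - p) / p` lies below both `λ⁻¹` and `p⁻¹`, so it serves for both terms.
  have h5 := mul_le_mul_of_nonneg_right (le_lam_inv hp hp1) h4
  have h6 : (1 - p) / p * (Real.log 2 * Real.exp s) ≤ Real.log 2 * Real.exp s / p := by
    rw [div_mul_eq_mul_div]
    refine div_le_div_of_nonneg_right ?_ hp.le
    exact mul_le_of_le_one_left (log_two_mul_exp_pos s).le (by linarith)
  have h7 := mul_le_mul_of_nonneg_left h2 (div_nonneg (by linarith : 0 ≤ 1 - p) hp.le)
  linarith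

/-- For sizes up to order `1 / p` the exponential bound is not available. Size 1 costs `O(p)`, and
the `O(1 / p)` other sizes cost `O(p ^ 2)` each, by `renewal_two_le` and monotonicity. -/
lemma renewal_one_le (hp : 0 < p) (hp1 : p < 1) : renewal p 1 ≤ p * (1 - p)⁻¹ := by
  have hq : 0 < 1 - p := by linarith
  have hG : ∫ r in Set.Ioi (0 : ℝ), p * (1 - p)⁻¹ * (Real.exp (-r) * r ^ ((2 : ℝ) - 1)) =
      p * (1 - p)⁻¹ := by
    rw [integral_const_mul, ← Real.Gamma_eq_integral two_pos, Real.Gamma_two, mul_one]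
  rw [← hG]
  refine setIntegral_mono_on (renewal_integrableOn hp hp1 1)
    ((Real.GammaIntegral_convergent two_pos).const_mul _) measurableSet_Ioi
    fun r (hr : 0 < r) => ?_
  have h1 := Real.add_one_le_exp (-(p * (1 - p)⁻¹ * r))
  have : r ^ ((2 : ℝ) - 1) = r := by norm_num
  rw [this]
  simp only [Finset.prod_range_one, zero_add, pow_one]
  have := mul_le_mul_of_nonneg_left
    (by linarith : 1 - Real.exp (-(p * (1 - p)⁻¹ * r)) ≤ p * (1 - p)⁻¹ * r) (Real.exp_pos (-r)).le
  linarith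

lemma renewal_two_le (hp : 0 < p) (hp1 : p < 1) :
    renewal p 2 ≤ 2 * p ^ 2 * (1 - p)⁻¹ ^ 3 := by
  have hq : 0 < 1 - p := by linarith
  have hG : ∫ r in Set.Ioi (0 : ℝ), p ^ 2 * (1 - p)⁻¹ ^ 3 * (Real.exp (-r) * r ^ ((3 : ℝ) - 1)) =
      2 * p ^ 2 * (1 - p)⁻¹ ^ 3 := by
    rw [integral_const_mul, ← Real.Gamma_eq_integral three_pos]
    have : (3 : ℝ) = (2 : ℕ) + 1 := by norm_num
    rw [this, Real.Gamma_nat_eq_factorial]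
    norm_num
    ring
  rw [← hG]
  refine setIntegral_mono_on (renewal_integrableOn hp hp1 2)
    ((Real.GammaIntegral_convergent three_pos).const_mul _) measurableSet_Ioi
    fun r (hr : 0 < r) => ?_
  have h1 := Real.add_one_le_exp (-(p * (1 - p)⁻¹ ^ (0 + 1) * r))
  have h2 := Real.add_one_le_exp (-(p * (1 - p)⁻¹ ^ (1 + 1) * r))
  have : r ^ ((3 : ℝ) - 1) = r ^ 2 := by norm_num
  rw [this]
  simp only [Finset.prod_range_succ, Finset.prod_range_zero, one_mul]
  have h3 := mul_le_mul (by linarith : 1 - Real.exp (-(p * (1 - p)⁻¹ ^ (0 + 1) * r)) ≤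
      p * (1 - p)⁻¹ ^ (0 + 1) * r)
    (by linarith : 1 - Real.exp (-(p * (1 - p)⁻¹ ^ (1 + 1) * r)) ≤ p * (1 - p)⁻¹ ^ (1 + 1) * r)
    (factor_nonneg hp hp1 1 hr.le) (mul_nonneg (coeff_pos hp hp1 0).le hr.le)
  have := mul_le_mul_of_nonneg_left h3 (Real.exp_pos (-r)).le
  refine this.trans (le_of_eq ?_)
  ring

end Bounds

/-! ### Covering before exit, and its integral formula. -/

/-- `X 0, X 1, …` are independent with the geometric distribution on `{1, 2, …}`. -/
structure IsGeometric {Ω : Type*} [MeasurableSpace Ω] (μ : Measure Ω) (p : ℝ) (X : ℕ → Ω → ℕ) :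
    Prop where
  pos : 0 < p
  lt_one : p < 1
  meas : ∀ i, Measurable (X i)
  indep : iIndepFun X μ
  prob : ∀ i j : ℕ, 1 ≤ j → μ {ω | X i ω = j} = ENNReal.ofReal (p * (1 - p) ^ (j - 1))

/-- The geometric weight of a finite set of positive integers. -/
noncomputable def weight (p : ℝ) (D : Finset ℕ) : ℝ := ∑ d ∈ D, p * (1 - p) ^ (d - 1)

lemma weight_Icc (p : ℝ) (k : ℕ) : weight p (Finset.Icc 1 k) = 1 - (1 - p) ^ k := by
  induction k with
  | zero => simp [weight]
  | succ k ih =>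
    unfold weight at *
    rw [Finset.sum_Icc_succ_top (by omega), ih, Nat.add_sub_cancel]
    ring

/-- The first `t` terms of `x` lie in `D` and take all values in `A`. -/
def Covers (x : ℕ → ℕ) (t : ℕ) (D A : Finset ℕ) : Prop :=
  (∀ i < t, x i ∈ D) ∧ ∀ a ∈ A, ∃ i < t, x i = a

/-- The sequence leaves `{1, …, k}` for the first time at time `t`, and takes all values in `A`
before. -/
def ExitsAt (x : ℕ → ℕ) (t k : ℕ) (A : Finset ℕ) : Prop :=
  Covers x t (Finset.Icc 1 k) A ∧ x t ∉ Finset.Icc 1 k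

lemma dependsOn_covers (t : ℕ) (D A : Finset ℕ) :
    DependsOn (fun x => Covers x t D A) (Finset.range t : Set ℕ) := by
  intro x y hxy
  have h : ∀ i < t, x i = y i := fun i hi => hxy i (by simpa using hi)
  refine propext (and_congr (forall₂_congr fun i hi => by rw [h i hi]) ?_)
  exact forall₂_congr fun a _ => exists_congr fun i => and_congr_right fun hi => by rw [h i hi]

lemma dependsOn_exitsAt (t k : ℕ) (A : Finset ℕ) :
    DependsOn (fun x => ExitsAt x t k A) (Finset.range (t + 1) : Set ℕ) := by
  intro x y hxy
  refine propext (and_congr ?_ ?_)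
  · exact iff_of_eq (dependsOn_covers t _ A fun i hi => hxy i (by simp at hi ⊢; omega))
  · rw [hxy t (by simp)]

lemma dependsOn_isFirstBlock (n j : ℕ) :
    DependsOn (fun x => IsFirstBlock x n j) (Finset.range n : Set ℕ) := by
  intro x y hxy
  have h : ∀ m ≤ n, x '' Set.Iio m = y '' Set.Iio m := fun m hm =>
    Set.image_congr fun i hi => hxy i (by simp at hi ⊢; omega)
  refine propext (and_congr_right fun _ => and_congr (by rw [h n le_rfl]) ?_)
  exact forall₂_congr fun m hm => by rw [h m hm.le]

lemma Covers.image_eq {x : ℕ → ℕ} {t k : ℕ} (h : Covers x t (Finset.Icc 1 k) (Finset.Ioc 0 k)) :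
    x '' Set.Iio t = Set.Icc 1 k := by
  apply Set.Subset.antisymm
  · rintro _ ⟨i, hi, rfl⟩
    simpa using h.1 i hi
  · intro a ha
    obtain ⟨i, hi, rfl⟩ := h.2 a (by simp at ha ⊢; omega)
    exact ⟨i, hi, rfl⟩

lemma ExitsAt.unique {x : ℕ → ℕ} {t t' k : ℕ} {A : Finset ℕ} (h : ExitsAt x t k A)
    (h' : ExitsAt x t' k A) : t = t' := by
  rcases lt_trichotomy t t' with hlt | heq | hlt
  · exact absurd (h'.1.1 t hlt) h.2
  · exact heq
  · exact absurd (h.1.1 t' hlt) h'.2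

/-- Values in `(j, k]` are absent from the first `n` samples, hence occur between `n` and `m`; no
exit from `{1, …, k}` occurs before `m`. -/
lemma exists_exitsAt {x : ℕ → ℕ} {n m j k : ℕ} (hn : x '' Set.Iio n = Set.Icc 1 j)
    (hm : x '' Set.Iio m = Set.Icc 1 k) (hexit : ∃ i, x (n + i) ∉ Finset.Icc 1 k) :
    ∃ t, ExitsAt (fun i => x (n + i)) t k (Finset.Ioc j k) := by
  classical
  refine ⟨Nat.find hexit, ⟨fun i hi => not_not.1 (Nat.find_min hexit hi), fun a ha => ?_⟩,
    Nat.find_spec hexit⟩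
  rw [Finset.mem_Ioc] at ha
  have ham : a ∈ x '' Set.Iio m := by rw [hm]; exact ⟨by omega, ha.2⟩
  obtain ⟨i, hi, rfl⟩ := ham
  have hni : n ≤ i := by
    by_contra hlt
    have : x i ∈ Set.Icc 1 j := hn ▸ ⟨i, not_le.1 hlt, rfl⟩
    exact absurd this.2 (by omega)
  have hmt : m ≤ n + Nat.find hexit := by
    by_contra hlt
    have : x (n + Nat.find hexit) ∈ Set.Icc 1 k := hm ▸ ⟨_, not_le.1 hlt, rfl⟩
    exact Nat.find_spec hexit (by simpa using this)
  have him : i < m := hi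
  exact ⟨i - n, by omega, by simp [Nat.add_sub_cancel' hni]⟩

/-- The total expected time during which a chain in `D` has covered `A`, where `c` is the exit
rate from `D`. -/
noncomputable def coverIntegral (p : ℝ) (A : Finset ℕ) (c : ℝ) : ℝ :=
  ∫ s in Set.Ioi (0 : ℝ), Real.exp (-c * s) *
    ∏ a ∈ A, (1 - Real.exp (-(p * (1 - p) ^ (a - 1)) * s))

lemma coverIntegral_integrableOn {p : ℝ} (hp : 0 ≤ p) (hp1 : p ≤ 1) (A : Finset ℕ) {c : ℝ}
    (hc : 0 < c) : IntegrableOn (fun s => Real.exp (-c * s) *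
    ∏ a ∈ A, (1 - Real.exp (-(p * (1 - p) ^ (a - 1)) * s))) (Set.Ioi 0) := by
  refine (integrableOn_exp_mul_Ioi (neg_lt_zero.2 hc) 0).mono'
    (Continuous.aestronglyMeasurable (by fun_prop)) ?_
  refine ae_restrict_of_forall_mem measurableSet_Ioi fun s (hs : 0 < s) => ?_
  rw [norm_mul, Real.norm_of_nonneg (Real.exp_pos _).le, norm_prod]
  refine mul_le_of_le_one_right (Real.exp_pos _).le (Finset.prod_le_one (fun _ _ => norm_nonneg _)
    fun a _ => ?_)
  have h1 : Real.exp (-(p * (1 - p) ^ (a - 1)) * s) ≤ 1 := Real.exp_le_one_iff.2 (by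
    have : 0 ≤ p * (1 - p) ^ (a - 1) := mul_nonneg hp (pow_nonneg (by linarith) _)
    nlinarith)
  have h2 := Real.exp_pos (-(p * (1 - p) ^ (a - 1)) * s)
  rw [Real.norm_of_nonneg (by linarith)]
  linarith

lemma coverIntegral_empty (p : ℝ) {c : ℝ} (hc : 0 < c) : coverIntegral p ∅ c = c⁻¹ := by
  simp only [coverIntegral, Finset.prod_empty, mul_one]
  rw [integral_exp_mul_Ioi (neg_lt_zero.2 hc)]
  simp

lemma coverIntegral_insert {p : ℝ} (hp : 0 ≤ p) (hp1 : p ≤ 1) {A : Finset ℕ} {a : ℕ} (ha : a ∉ A)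
    {c : ℝ} (hc : 0 < c) : coverIntegral p (insert a A) c =
      coverIntegral p A c - coverIntegral p A (c + p * (1 - p) ^ (a - 1)) := by
  have : 0 ≤ p * (1 - p) ^ (a - 1) := mul_nonneg hp (pow_nonneg (by linarith) _)
  unfold coverIntegral
  rw [← integral_sub (coverIntegral_integrableOn hp hp1 A hc)
    (coverIntegral_integrableOn hp hp1 A (by linarith))]
  congr 1
  ext s
  rw [Finset.prod_insert ha, neg_add, add_mul, Real.exp_add]
  ring

/-- Substitute `r = (1 - p) ^ k * s` and `l = k - a`. Geometric weights are self-similar, so only `k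
- j` matters; this is the source of the renewal structure. -/
lemma coverIntegral_eq_renewal {p : ℝ} (hp1 : p < 1) {j k : ℕ} (hjk : j ≤ k) :
    (1 - p) ^ k * coverIntegral p (Finset.Ioc j k) ((1 - p) ^ k) = renewal p (k - j) := by
  have hq : 0 < 1 - p := by linarith
  have hqk : 0 < (1 - p) ^ k := pow_pos hq k
  have h := integral_comp_mul_left_Ioi (fun r : ℝ => Real.exp (-r) *
    ∏ l ∈ Finset.range (k - j), (1 - Real.exp (-(p * (1 - p)⁻¹ ^ (l + 1) * r)))) 0 hqk
  rw [mul_zero, smul_eq_mul] at h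
  have h2 : coverIntegral p (Finset.Ioc j k) ((1 - p) ^ k) =
      ((1 - p) ^ k)⁻¹ * renewal p (k - j) := by
    rw [renewal, ← h, coverIntegral]
    congr 1
    ext s
    congr 1
    · rw [neg_mul]
    · refine Finset.prod_nbij' (fun a => k - a) (fun l => k - l) ?_ ?_ ?_ ?_ ?_
      · intro a ha; simp at ha ⊢; omega
      · intro l hl; simp at hl ⊢; omega
      · intro a ha; simp at ha ⊢; omega
      · intro l hl; simp at hl ⊢; omega
      · intro a ha
        rw [Finset.mem_Ioc] at ha
        have : (1 - p)⁻¹ ^ (k - a + 1) * (1 - p) ^ k = (1 - p) ^ (a - 1) := by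
          rw [inv_pow, inv_mul_eq_iff_eq_mul₀ (pow_pos hq _).ne', ← pow_add]
          congr 1
          omega
        rw [← this]
        congr 2
        ring
  rw [h2, mul_inv_cancel_left₀ hqk.ne']

/-! ### Probabilities for independent geometric samples. -/

namespace IsGeometric

variable {Ω : Type*} [MeasurableSpace Ω] {μ : Measure Ω} {p : ℝ}
  {X : ℕ → Ω → ℕ}

lemma shift (h : IsGeometric μ p X) (n : ℕ) : IsGeometric μ p (fun i => X (n + i)) where
  pos := h.pos
  lt_one := h.lt_one
  meas _ := h.meas _
  indep := h.indep.precomp (add_right_injective n)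
  prob _ j hj := h.prob _ j hj

lemma q_pos (h : IsGeometric μ p X) : 0 < 1 - p := by linarith [h.lt_one]

lemma exists_set_of_dependsOn {Ω : Type*} {X : ℕ → Ω → ℕ} {Q : (ℕ → ℕ) → Prop} {S : Finset ℕ} (hQ : DependsOn Q (S : Set ℕ)) :
    ∃ B : Set (S → ℕ), {ω | Q fun i => X i ω} = (fun ω (i : S) => X i ω) ⁻¹' B := by
  classical
  refine ⟨{y | Q fun i => if hi : i ∈ S then y ⟨i, hi⟩ else 0}, ?_⟩
  ext ω
  have : Q (fun i => X i ω) = Q (fun i => if i ∈ S then X i ω else 0) :=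
    hQ fun i hi => by simp [Finset.mem_coe.1 hi]
  simp [this]

lemma measurableSet_of_dependsOn (h : IsGeometric μ p X) {Q : (ℕ → ℕ) → Prop} {S : Finset ℕ}
    (hQ : DependsOn Q (S : Set ℕ)) : MeasurableSet {ω | Q fun i => X i ω} := by
  obtain ⟨B, hB⟩ := exists_set_of_dependsOn (X := X) hQ
  rw [hB]
  exact (measurable_pi_lambda (fun ω (i : S) => X i ω) fun i => h.meas i) MeasurableSet.of_discrete

lemma measure_inter_of_dependsOn (h : IsGeometric μ p X) {Q R : (ℕ → ℕ) → Prop} {S T : Finset ℕ}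
    (hST : Disjoint S T) (hQ : DependsOn Q (S : Set ℕ)) (hR : DependsOn R (T : Set ℕ)) :
    μ ({ω | Q fun i => X i ω} ∩ {ω | R fun i => X i ω}) =
      μ {ω | Q fun i => X i ω} * μ {ω | R fun i => X i ω} := by
  obtain ⟨B, hB⟩ := exists_set_of_dependsOn (X := X) hQ
  obtain ⟨C, hC⟩ := exists_set_of_dependsOn (X := X) hR
  rw [hB, hC]
  exact (h.indep.indepFun_finset S T hST h.meas).measure_inter_preimage_eq_mul _ _
    MeasurableSet.of_discrete MeasurableSet.of_discrete

lemma weight_lt_one (h : IsGeometric μ p X) {D : Finset ℕ} {k : ℕ} (hD : D ⊆ Finset.Icc 1 k) :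
    weight p D < 1 := by
  have hq := h.q_pos
  have hp := h.pos
  have h1 : weight p D ≤ weight p (Finset.Icc 1 k) :=
    Finset.sum_le_sum_of_subset_of_nonneg hD fun _ _ _ => by positivity
  rw [weight_Icc] at h1
  linarith [pow_pos hq k]

lemma weight_nonneg (h : IsGeometric μ p X) (D : Finset ℕ) : 0 ≤ weight p D :=
  Finset.sum_nonneg fun _ _ => mul_nonneg h.pos.le (pow_nonneg h.q_pos.le _)

lemma measure_isFirstBlock_inter_exitsAt (h : IsGeometric μ p X) (n j t k : ℕ) (A : Finset ℕ) :
    μ ({ω | IsFirstBlock (fun i => X i ω) n j} ∩ {ω | ExitsAt (fun i => X (n + i) ω) t k A}) =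
      μ {ω | IsFirstBlock (fun i => X i ω) n j} *
        μ {ω | ExitsAt (fun i => X (n + i) ω) t k A} := by
  refine h.measure_inter_of_dependsOn (S := Finset.range n)
    (R := fun x => ExitsAt (fun i => x (n + i)) t k A)
    (T := Finset.Ico n (n + (t + 1))) ?_ (dependsOn_isFirstBlock n j) fun x y hxy => ?_
  · rw [Finset.disjoint_left]; intro a ha; simp at ha ⊢; omega
  · exact dependsOn_exitsAt t k A fun i hi => hxy (n + i) (by simp at hi ⊢; omega)

lemma sum_measure_isFirstBlock (h : IsGeometric μ p X) (m : ℕ) :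
    ∑ j ∈ Finset.Icc 1 m, ∑' n, μ {ω | IsFirstBlock (fun i => X i ω) n j} =
      μ {ω | ∃ n, ∃ j ≤ m, IsFirstBlock (fun i => X i ω) n j} := by
  have hmeas : ∀ n j, MeasurableSet {ω | IsFirstBlock (fun i => X i ω) n j} :=
    fun n j => h.measurableSet_of_dependsOn (dependsOn_isFirstBlock n j)
  have h1 : ∀ j, ∑' n, μ {ω | IsFirstBlock (fun i => X i ω) n j} =
      μ (⋃ n, {ω | IsFirstBlock (fun i => X i ω) n j}) := fun j =>
    (measure_iUnion (f := fun n => {ω | IsFirstBlock (fun i => X i ω) n j})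
      (fun n n' hne => Set.disjoint_left.2 fun ω h1 h2 =>
        hne (IsFirstBlock.unique (x := fun i => X i ω) h1 h2).1) fun n => hmeas n j).symm
  simp_rw [h1]
  rw [← measure_biUnion_finset]
  · congr 1
    ext ω
    simp only [Set.mem_iUnion, Finset.mem_Icc, Set.mem_ofPred_eq, exists_prop]
    exact ⟨fun ⟨j, hj, n, hb⟩ => ⟨n, j, hj.2, hb⟩, fun ⟨n, j, hj, hb⟩ => ⟨j, ⟨hb.1, hj⟩, n, hb⟩⟩
  · intro j _ j' _ hne
    refine Set.disjoint_left.2 fun ω h1 h2 => ?_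
    obtain ⟨n, hn⟩ := Set.mem_iUnion.1 h1
    obtain ⟨n', hn'⟩ := Set.mem_iUnion.1 h2
    exact hne (IsFirstBlock.unique hn hn').2
  · exact fun j _ => MeasurableSet.iUnion fun n => hmeas n j

lemma measure_exists_eq_le (h : IsGeometric μ p X) (t m : ℕ) (hm : 1 ≤ m) :
    μ {ω | ∃ i < t, X i ω = m} ≤ ENNReal.ofReal (t * (1 - p) ^ (m - 1)) := by
  have hq := h.q_pos
  have h1 : {ω | ∃ i < t, X i ω = m} = ⋃ i ∈ Finset.range t, {ω | X i ω = m} := by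
    ext ω; simp
  rw [h1]
  refine (measure_biUnion_finset_le _ _).trans ?_
  simp_rw [h.prob _ m hm]
  rw [Finset.sum_const, Finset.card_range, nsmul_eq_mul, ENNReal.ofReal_mul (Nat.cast_nonneg t),
    ENNReal.ofReal_natCast]
  gcongr
  exact mul_le_of_le_one_left (by positivity) h.lt_one.le

variable [IsProbabilityMeasure μ]

lemma real_mem (h : IsGeometric μ p X) (i : ℕ) {D : Finset ℕ} {k : ℕ} (hD : D ⊆ Finset.Icc 1 k) :
    μ.real {ω | X i ω ∈ D} = weight p D := by
  have h1 : {ω | X i ω ∈ D} = X i ⁻¹' (D : Set ℕ) := rfl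
  rw [h1, ← map_measureReal_apply (h.meas i) D.measurableSet, ← sum_measureReal_singleton]
  refine Finset.sum_congr rfl fun d hd => ?_
  rw [map_measureReal_apply (h.meas i) (measurableSet_singleton d)]
  have h2 : X i ⁻¹' {d} = {ω | X i ω = d} := rfl
  have := h.q_pos
  have := h.pos
  rw [h2, measureReal_def, h.prob i d (Finset.mem_Icc.1 (hD hd)).1,
    ENNReal.toReal_ofReal (by positivity)]

lemma real_forall_mem (h : IsGeometric μ p X) (t : ℕ) {D : Finset ℕ} {k : ℕ}
    (hD : D ⊆ Finset.Icc 1 k) : μ.real {ω | ∀ i < t, X i ω ∈ D} = weight p D ^ t := by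
  have h1 : {ω | ∀ i < t, X i ω ∈ D} = ⋂ i ∈ Finset.range t, X i ⁻¹' (D : Set ℕ) := by
    ext ω; simp
  have h2 := h.indep.measure_inter_preimage_eq_mul (Finset.range t) (sets := fun _ => (D : Set ℕ))
    fun i _ => D.measurableSet
  rw [h1, measureReal_def, h2, ENNReal.toReal_prod]
  have h3 : ∀ i ∈ Finset.range t, (μ (X i ⁻¹' (D : Set ℕ))).toReal = weight p D :=
    fun i _ => h.real_mem i hD
  rw [Finset.prod_congr rfl h3]
  simp

lemma real_covers_insert (h : IsGeometric μ p X) (t : ℕ) (D A : Finset ℕ) (a : ℕ) :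
    μ.real {ω | Covers (fun i => X i ω) t D (insert a A)} =
      μ.real {ω | Covers (fun i => X i ω) t D A} -
        μ.real {ω | Covers (fun i => X i ω) t (D.erase a) A} := by
  have hsub : {ω | Covers (fun i => X i ω) t (D.erase a) A} ⊆
      {ω | Covers (fun i => X i ω) t D A} :=
    fun ω hω => ⟨fun i hi => Finset.mem_of_mem_erase (hω.1 i hi), hω.2⟩
  rw [← measureReal_sdiff hsub (h.measurableSet_of_dependsOn (dependsOn_covers t _ A))]
  congr 1
  ext ω
  simp only [Covers, Set.mem_ofPred_eq, Set.mem_sdiff, Finset.mem_insert, forall_eq_or_imp,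
    Finset.mem_erase]
  constructor
  · rintro ⟨h1, ⟨i, hi, hia⟩, h3⟩
    exact ⟨⟨h1, h3⟩, fun h4 => (h4.1 i hi).1 hia⟩
  · rintro ⟨⟨h1, h3⟩, h4⟩
    refine ⟨h1, ?_, h3⟩
    by_contra hno
    push Not at hno
    exact h4 ⟨fun i hi => ⟨hno i hi, h1 i hi⟩, h3⟩

/-- Inclusion-exclusion as an induction on `A`: the base case is a geometric series, and missing `a`
means staying in `D.erase a`, which raises the exit rate by the weight of `a`. Both sides satisfy
the same recursion. -/
lemma hasSum_covers (h : IsGeometric μ p X) {k : ℕ} (A : Finset ℕ) :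
    ∀ D : Finset ℕ, A ⊆ D → D ⊆ Finset.Icc 1 k →
      HasSum (fun t => μ.real {ω | Covers (fun i => X i ω) t D A})
        (coverIntegral p A (1 - weight p D)) := by
  induction A using Finset.induction_on with
  | empty =>
    intro D _ hD
    have hW := h.weight_lt_one hD
    rw [coverIntegral_empty p (by linarith)]
    have : (fun t => μ.real {ω | Covers (fun i => X i ω) t D ∅}) = fun t => weight p D ^ t := by
      ext t
      rw [← h.real_forall_mem t hD]
      simp [Covers]
    rw [this]
    exact hasSum_geometric_of_lt_one (h.weight_nonneg D) hW
  | insert a A ha ih =>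
    intro D hAD hD
    have hW := h.weight_lt_one hD
    have haD : a ∈ D := hAD (Finset.mem_insert_self a A)
    have hA : A ⊆ D := (Finset.subset_insert a A).trans hAD
    have hA' : A ⊆ D.erase a := fun x hx =>
      Finset.mem_erase.2 ⟨fun hxa => ha (hxa ▸ hx), hA hx⟩
    have hw : 1 - weight p (D.erase a) = 1 - weight p D + p * (1 - p) ^ (a - 1) := by
      have := Finset.add_sum_erase D (fun d => p * (1 - p) ^ (d - 1)) haD
      unfold weight
      linarith
    rw [coverIntegral_insert h.pos.le h.lt_one.le ha (by linarith), ← hw]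
    simp_rw [h.real_covers_insert _ D A a]
    exact (ih D hA hD).sub (ih _ hA' ((Finset.erase_subset a D).trans hD))

lemma measure_exitsAt (h : IsGeometric μ p X) (t k : ℕ) (A : Finset ℕ) :
    μ {ω | ExitsAt (fun i => X i ω) t k A} =
      ENNReal.ofReal ((1 - p) ^ k * μ.real {ω | Covers (fun i => X i ω) t (Finset.Icc 1 k) A}) := by
  have h1 := h.measure_inter_of_dependsOn (Q := fun x => Covers x t (Finset.Icc 1 k) A)
    (R := fun x => x t ∉ Finset.Icc 1 k) (S := Finset.range t) (T := {t}) (by simp)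
    (dependsOn_covers t _ A) (fun x y hxy => by simp only [hxy t (by simp)])
  have h2 : μ.real {ω | X t ω ∉ Finset.Icc 1 k} = (1 - p) ^ k := by
    have h3 : {ω | X t ω ∉ Finset.Icc 1 k} = (X t ⁻¹' (Finset.Icc 1 k : Finset ℕ))ᶜ := rfl
    rw [h3, probReal_compl_eq_one_sub (h.meas t (Finset.measurableSet _))]
    have h5 := h.real_mem t (subset_refl (Finset.Icc 1 k))
    rw [weight_Icc] at h5
    change 1 - μ.real {ω | X t ω ∈ Finset.Icc 1 k} = _
    rw [h5]
    ring
  have h4 : {ω | ExitsAt (fun i => X i ω) t k A} =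
    {ω | Covers (fun i => X i ω) t (Finset.Icc 1 k) A} ∩ {ω | X t ω ∉ Finset.Icc 1 k} := rfl
  rw [h4, h1, mul_comm, ENNReal.ofReal_mul (pow_pos h.q_pos k).le, ← h2, ofReal_measureReal,
    ofReal_measureReal]

lemma tsum_exitsAt (h : IsGeometric μ p X) {j k : ℕ} (hjk : j ≤ k) :
    ∑' t, μ {ω | ExitsAt (fun i => X i ω) t k (Finset.Ioc j k)} =
      ENNReal.ofReal (renewal p (k - j)) := by
  have h1 := h.hasSum_covers (k := k) (Finset.Ioc j k) (Finset.Icc 1 k)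
    (fun a ha => by simp at ha ⊢; omega) (subset_refl _)
  rw [weight_Icc, sub_sub_cancel] at h1
  have h2 := h1.mul_left ((1 - p) ^ k)
  rw [coverIntegral_eq_renewal h.lt_one hjk] at h2
  simp_rw [h.measure_exitsAt]
  rw [← ENNReal.ofReal_tsum_of_nonneg _ h2.summable, h2.tsum_eq]
  exact fun t => mul_nonneg (pow_pos h.q_pos k).le measureReal_nonneg

lemma ae_exists_notMem_Icc (h : IsGeometric μ p X) (k : ℕ) :
    ∀ᵐ ω ∂μ, ∃ i, X i ω ∉ Finset.Icc 1 k := by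
  have h1 : ∀ t, μ.real {ω | ∀ i, X i ω ∈ Finset.Icc 1 k} ≤ weight p (Finset.Icc 1 k) ^ t := by
    intro t
    rw [← h.real_forall_mem t (subset_refl _)]
    exact measureReal_mono fun ω hω i _ => hω i
  have h2 : μ.real {ω | ∀ i, X i ω ∈ Finset.Icc 1 k} ≤ 0 :=
    ge_of_tendsto' (tendsto_pow_atTop_nhds_zero_of_lt_one (h.weight_nonneg _)
      (h.weight_lt_one (subset_refl _))) h1
  have h3 : μ {ω | ∀ i, X i ω ∈ Finset.Icc 1 k} = 0 :=
    (measureReal_eq_zero_iff).1 (le_antisymm h2 measureReal_nonneg)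
  rw [ae_iff]
  simpa only [not_exists, not_not] using h3

lemma renewal_le_measure_block (h : IsGeometric μ p X) (k : ℕ) :
    ENNReal.ofReal (renewal p k) ≤ μ {ω | ∃ n, (fun i => X i ω) '' Set.Iio n = Set.Icc 1 k} := by
  rw [← Nat.sub_zero k, ← h.tsum_exitsAt (Nat.zero_le k), Nat.sub_zero, ← measure_iUnion]
  · refine measure_mono fun ω hω => ?_
    obtain ⟨t, ht⟩ := Set.mem_iUnion.1 hω
    exact ⟨t, ht.1.image_eq⟩
  · intro t t' htt'
    exact Set.disjoint_left.2 fun ω h1 h2 => htt' (ExitsAt.unique h1 h2)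
  · exact fun t => h.measurableSet_of_dependsOn (dependsOn_exitsAt t k _)

lemma measure_block_le_renewal (h : IsGeometric μ p X) (k : ℕ) :
    μ {ω | ∃ n, (fun i => X i ω) '' Set.Iio n = Set.Icc 1 k} ≤ ENNReal.ofReal (renewal p k) := by
  rw [← Nat.sub_zero k, ← h.tsum_exitsAt (Nat.zero_le k), Nat.sub_zero]
  refine le_trans (measure_mono_ae ?_) (measure_iUnion_le _)
  filter_upwards [h.ae_exists_notMem_Icc k] with ω hω ⟨n, hn⟩
  obtain ⟨t, ht⟩ := exists_exitsAt (x := fun i => X i ω) (n := 0) (j := 0) (by simp)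
    hn (by simpa using hω)
  exact Set.mem_iUnion.2 ⟨t, by simpa using ht⟩

/-! ### The renewal inequality and the exceptional events. -/

/-- The renewal inequality. -/
lemma renewal_le_sum (h : IsGeometric μ p X) {k : ℕ} (hk : 1 ≤ k) :
    ENNReal.ofReal (renewal p k) ≤ ∑ j ∈ Finset.Icc 1 k,
      (∑' n, μ {ω | IsFirstBlock (fun i => X i ω) n j}) * ENNReal.ofReal (renewal p (k - j)) := by
  refine (h.renewal_le_measure_block k).trans ?_
  have hsub : {ω | ∃ n, (fun i => X i ω) '' Set.Iio n = Set.Icc 1 k} ≤ᵐ[μ]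
      ⋃ j ∈ Finset.Icc 1 k, ⋃ n, ⋃ t, ({ω | IsFirstBlock (fun i => X i ω) n j} ∩
        {ω | ExitsAt (fun i => X (n + i) ω) t k (Finset.Ioc j k)}) := by
    have hex := ae_all_iff.2 fun n => (h.shift n).ae_exists_notMem_Icc k
    filter_upwards [hex] with ω hω ⟨m, hm⟩
    -- Split at the first block: after time `n` the samples must cover `(j, k]` before leaving `{1,
    -- …, k}`, and they are independent of the first `n`.
    obtain ⟨n, -, j, hjk, hb⟩ := exists_isFirstBlock hk hm
    obtain ⟨t, ht⟩ := exists_exitsAt hb.2.1 hm (hω n)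
    refine Set.mem_iUnion₂.2 ⟨j, Finset.mem_Icc.2 ⟨hb.1, hjk⟩, ?_⟩
    exact Set.mem_iUnion₂.2 ⟨n, t, hb, ht⟩
  refine (measure_mono_ae hsub).trans ((measure_biUnion_finset_le _ _).trans ?_)
  refine Finset.sum_le_sum fun j hj => ?_
  rw [← ENNReal.tsum_mul_right]
  refine (measure_iUnion_le _).trans (ENNReal.tsum_le_tsum fun n => ?_)
  refine (measure_iUnion_le _).trans (le_of_eq ?_)
  simp_rw [h.measure_isFirstBlock_inter_exitsAt]
  rw [ENNReal.tsum_mul_left, (h.shift n).tsum_exitsAt (Finset.mem_Icc.1 hj).2]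

/-- Sum the renewal inequality over `k ≤ m` and exchange the sums. Each inner sum runs over the
sizes `0, …, m - j`; the 1 is the term of size 0. -/
lemma sum_renewal_le (h : IsGeometric μ p X) (m : ℕ) :
    ∑ k ∈ Finset.Icc 1 m, renewal p k ≤
      μ.real {ω | ∃ n, ∃ j ≤ m, IsFirstBlock (fun i => X i ω) n j} *
        (1 + ∑ k ∈ Finset.Icc 1 m, renewal p k) := by
  have hu := renewal_nonneg h.pos h.lt_one
  set f : ℕ → ENNReal := fun j => ∑' n, μ {ω | IsFirstBlock (fun i => X i ω) n j} with hf
  have hsum := h.sum_measure_isFirstBlock m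
  have htop : ∀ j ∈ Finset.Icc 1 m, f j ≠ ⊤ := by
    intro j hj
    refine ((Finset.single_le_sum (f := f) (fun _ _ => zero_le) hj).trans_lt ?_).ne
    rw [hf, hsum]
    exact measure_lt_top _ _
  have hreal : ∑ j ∈ Finset.Icc 1 m, (f j).toReal =
      μ.real {ω | ∃ n, ∃ j ≤ m, IsFirstBlock (fun i => X i ω) n j} := by
    rw [measureReal_def, ← hsum, ENNReal.toReal_sum htop]
  have hren : ∀ k ∈ Finset.Icc 1 m, renewal p k ≤
      ∑ j ∈ Finset.Icc 1 k, (f j).toReal * renewal p (k - j) := by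
    intro k hk
    rw [Finset.mem_Icc] at hk
    have h1 := h.renewal_le_sum hk.1
    have hsub : ∀ j ∈ Finset.Icc 1 k, f j * ENNReal.ofReal (renewal p (k - j)) ≠ ⊤ := fun j hj =>
      ENNReal.mul_ne_top (htop j (by simp at hj ⊢; omega)) ENNReal.ofReal_ne_top
    have h2 := ENNReal.toReal_mono (ENNReal.sum_ne_top.2 hsub) h1
    rw [ENNReal.toReal_ofReal (hu k), ENNReal.toReal_sum hsub] at h2
    simpa only [ENNReal.toReal_mul, ENNReal.toReal_ofReal (hu _)] using h2
  calc ∑ k ∈ Finset.Icc 1 m, renewal p k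
      ≤ ∑ k ∈ Finset.Icc 1 m, ∑ j ∈ Finset.Icc 1 k, (f j).toReal * renewal p (k - j) :=
        Finset.sum_le_sum hren
    _ = ∑ j ∈ Finset.Icc 1 m, ∑ k ∈ Finset.Icc j m, (f j).toReal * renewal p (k - j) :=
        Finset.sum_comm' fun k j => by simp only [Finset.mem_Icc]; omega
    _ ≤ ∑ j ∈ Finset.Icc 1 m, (f j).toReal * (1 + ∑ k ∈ Finset.Icc 1 m, renewal p k) := by
        refine Finset.sum_le_sum fun j hj => ?_
        rw [← Finset.mul_sum]
        refine mul_le_mul_of_nonneg_left ?_ ENNReal.toReal_nonneg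
        rw [Finset.mem_Icc] at hj
        rw [← renewal_zero p, ← Finset.sum_insert (by simp)]
        calc ∑ k ∈ Finset.Icc j m, renewal p (k - j)
            = ∑ i ∈ (Finset.Icc j m).image (fun k => k - j), renewal p i := by
              rw [Finset.sum_image]
              intro a ha c hc hac
              simp at ha hc hac
              omega
          _ ≤ _ := by
              refine Finset.sum_le_sum_of_subset_of_nonneg ?_ fun i _ _ => hu i
              intro i hi
              simp only [Finset.mem_image, Finset.mem_Icc, Finset.mem_insert] at hi ⊢
              omega
    _ = _ := by rw [← Finset.sum_mul, hreal]

/-- The inequality `U ≤ F (1 + U)` of `sum_renewal_le` rearranges to `1 - F ≤ 1 / (1 + U)`, and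
`le_renewal` bounds each term of `U` from below. -/
lemma measure_no_block_le (h : IsGeometric μ p X) (m : ℕ) :
    μ {ω | ¬ ∃ n, ∃ j ≤ m, IsFirstBlock (fun i => X i ω) n j} ≤
      ENNReal.ofReal (1 + m * (Real.exp (-1) * Real.exp (-(b / p))))⁻¹ := by
  have hmeas : MeasurableSet {ω | ∃ n, ∃ j ≤ m, IsFirstBlock (fun i => X i ω) n j} := by
    simp only [Set.ofPred_exists]
    refine MeasurableSet.iUnion fun n => MeasurableSet.iUnion fun j => ?_
    by_cases hj : j ≤ m
    · simpa [hj] using h.measurableSet_of_dependsOn (dependsOn_isFirstBlock n j)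
    · simp [hj]
  have h1 := h.sum_renewal_le m
  have h2 : m * (Real.exp (-1) * Real.exp (-(b / p))) ≤ ∑ k ∈ Finset.Icc 1 m, renewal p k := by
    have := Finset.card_nsmul_le_sum (Finset.Icc 1 m) (renewal p) _
      fun k _ => le_renewal h.pos h.lt_one k
    simpa using this
  have h3 : 0 ≤ m * (Real.exp (-1) * Real.exp (-(b / p))) := by positivity
  have h4 : {ω | ¬ ∃ n, ∃ j ≤ m, IsFirstBlock (fun i => X i ω) n j} =
    {ω | ∃ n, ∃ j ≤ m, IsFirstBlock (fun i => X i ω) n j}ᶜ := rfl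
  rw [← ofReal_measureReal, h4, probReal_compl_eq_one_sub hmeas]
  refine ENNReal.ofReal_le_ofReal ?_
  set F := μ.real {ω | ∃ n, ∃ j ≤ m, IsFirstBlock (fun i => X i ω) n j} with hF
  have hF1 : F ≤ 1 := measureReal_le_one
  rw [← one_div, le_div_iff₀ (by linarith)]
  have := mul_le_mul_of_nonneg_left h2 (sub_nonneg.2 hF1)
  nlinarith

lemma measure_forall_mem_Icc_le (h : IsGeometric μ p X) (t m : ℕ) :
    μ {ω | ∀ i < t, X i ω ∈ Finset.Icc 1 m} ≤ ENNReal.ofReal (Real.exp (-(t * (1 - p) ^ m))) := by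
  rw [← ofReal_measureReal, h.real_forall_mem t (subset_refl _), weight_Icc]
  refine ENNReal.ofReal_le_ofReal ?_
  have h1 := Real.add_one_le_exp (-(1 - p) ^ m)
  have h2 : 0 ≤ 1 - (1 - p) ^ m := by
    have := pow_le_one₀ (n := m) h.q_pos.le (by linarith [h.pos])
    linarith
  calc (1 - (1 - p) ^ m) ^ t ≤ (Real.exp (-(1 - p) ^ m)) ^ t :=
        pow_le_pow_left₀ h2 (by linarith) t
    _ = _ := by rw [← Real.exp_nat_mul]; congr 1; ring

/-- The exceptional events for a block that is too small or too large, or found too early or too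
late. -/
lemma one_le_measure_add (h : IsGeometric μ p X) {m₁ m₂ t₁ t₂ : ℕ} (hm₁ : 1 ≤ m₁) :
    1 ≤ μ {ω | ∃ n, t₁ ≤ n ∧ n ≤ t₂ ∧ numSamples (fun i => X i ω) = (n : ℕ∞)} +
      (ENNReal.ofReal (∑ k ∈ Finset.Ico 1 m₁, renewal p k) +
        ENNReal.ofReal (1 + m₂ * (Real.exp (-1) * Real.exp (-(b / p))))⁻¹ +
        ENNReal.ofReal (t₁ * (1 - p) ^ (m₁ - 1)) +
        ENNReal.ofReal (Real.exp (-(t₂ * (1 - p) ^ m₂)))) := by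
  have hsmall : μ (⋃ k ∈ Finset.Ico 1 m₁,
      {ω | ∃ n, (fun i => X i ω) '' Set.Iio n = Set.Icc 1 k}) ≤
      ENNReal.ofReal (∑ k ∈ Finset.Ico 1 m₁, renewal p k) := by
    rw [ENNReal.ofReal_sum_of_nonneg fun k _ => renewal_nonneg h.pos h.lt_one k]
    exact (measure_biUnion_finset_le _ _).trans
      (Finset.sum_le_sum fun k _ => h.measure_block_le_renewal k)
  refine le_trans ?_ (add_le_add le_rfl (add_le_add (add_le_add (add_le_add hsmall
    (h.measure_no_block_le m₂)) (h.measure_exists_eq_le t₁ m₁ hm₁))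
    (h.measure_forall_mem_Icc_le t₂ m₂)))
  rw [← measure_univ (μ := μ)]
  refine le_trans (measure_mono ?_) ((measure_union_le _ _).trans (add_le_add le_rfl
    ((measure_union_le _ _).trans (add_le_add ((measure_union_le _ _).trans (add_le_add
    (measure_union_le _ _) le_rfl)) le_rfl))))
  intro ω _
  by_contra hω
  simp only [Set.mem_union, not_or] at hω
  -- Off the bad events the first block has size in `[m₁, m₂]`. It contains `m₁`, which is not seen
  -- in the first `t₁` samples, and some sample among the first `t₂` lies outside `{1, …, m₂}`.
  obtain ⟨hgood, ⟨⟨hs, hl⟩, he⟩, ha⟩ := hω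
  obtain ⟨n, j, hj, hb⟩ := not_not.1 hl
  have hjm : m₁ ≤ j := by
    by_contra hlt
    exact hs (Set.mem_iUnion₂.2 ⟨j, Finset.mem_Ico.2 ⟨hb.1, not_le.1 hlt⟩, n, hb.2.1⟩)
  refine hgood ⟨n, ?_, ?_, hb.numSamples_eq⟩
  · by_contra hlt
    have hmem : m₁ ∈ (fun i => X i ω) '' Set.Iio n := by rw [hb.2.1]; exact ⟨hm₁, hjm⟩
    obtain ⟨i, hi, him⟩ := hmem
    exact he ⟨i, lt_trans hi (not_le.1 hlt), him⟩
  · by_contra hlt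
    refine ha fun i hi => ?_
    have hmem : X i ω ∈ Set.Icc 1 j := hb.2.1 ▸ ⟨i, lt_trans hi (not_le.1 hlt), rfl⟩
    exact Finset.mem_Icc.2 ⟨hmem.1, hmem.2.trans hj⟩

end IsGeometric

/-! ### The four error terms vanish as `p ↓ 0`. -/

lemma tendsto_exp_neg_div {c : ℝ} (hc : 0 < c) :
    Tendsto (fun p : ℝ => Real.exp (-(c / p))) (𝓝[>] 0) (𝓝 0) := by
  have h : Tendsto (fun p : ℝ => c * p⁻¹) (𝓝[>] 0) atTop :=
    tendsto_inv_nhdsGT_zero.const_mul_atTop hc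
  simp only [div_eq_mul_inv]
  exact Real.tendsto_exp_neg_atTop_nhds_zero.comp h

lemma tendsto_id_nhdsGT : Tendsto (fun p : ℝ => p) (𝓝[>] 0) (𝓝 0) :=
  tendsto_nhdsWithin_of_tendsto_nhds tendsto_id

lemma eventually_pos : ∀ᶠ p : ℝ in 𝓝[>] 0, 0 < p := self_mem_nhdsWithin

lemma eventually_lt {c : ℝ} (hc : 0 < c) : ∀ᶠ p : ℝ in 𝓝[>] 0, p < c :=
  tendsto_id_nhdsGT.eventually_lt_const hc

lemma eventually_two_le_mul_exp {c : ℝ} (hc : 0 < c) :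
    ∀ᶠ p : ℝ in 𝓝[>] 0, 2 ≤ p * Real.exp (c / p) := by
  filter_upwards [eventually_pos, eventually_lt (by positivity : 0 < c ^ 2 / 4)] with p hp hpc
  have h1 := Real.quadratic_le_exp_of_nonneg (div_pos hc hp).le
  have h2 : p * (c / p) ^ 2 = c ^ 2 / p := by field_simp
  have h3 : 4 ≤ c ^ 2 / p := by rw [le_div_iff₀ hp]; linarith
  have h4 := mul_le_mul_of_nonneg_left h1 hp.le
  have h5 : 0 ≤ p * (1 + c / p) := by have := div_pos hc hp; positivity
  nlinarith

lemma sum_renewal_le_of_le {p : ℝ} (hp : 0 < p) (hp1 : p < 1) {k₀ : ℕ} {E : ℝ} (hE : 0 ≤ E)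
    (h : ∀ k, k₀ ≤ k → renewal p k ≤ E) (m : ℕ) :
    ∑ k ∈ Finset.Ico 1 (m + 1), renewal p k ≤
      p * (1 - p)⁻¹ + k₀ * (2 * p ^ 2 * (1 - p)⁻¹ ^ 3) + m * E := by
  have hq : 0 < 1 - p := by linarith
  have h1 := renewal_one_le hp hp1
  have h2 := renewal_two_le hp hp1
  set a := p * (1 - p)⁻¹ with ha
  set c := 2 * p ^ 2 * (1 - p)⁻¹ ^ 3 with hc
  have ha0 : 0 ≤ a := by positivity
  have hc0 : 0 ≤ c := by positivity
  have hterm : ∀ k ∈ Finset.Ico 1 (m + 1), renewal p k ≤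
      (if k = 1 then a else 0) + (if k < k₀ then c else 0) + E := by
    intro k hk
    have hk1 := (Finset.mem_Ico.1 hk).1
    have hi1 : 0 ≤ if k = 1 then a else 0 := by split_ifs <;> simp [ha0]
    have hi2 : 0 ≤ if k < k₀ then c else 0 := by split_ifs <;> simp [hc0]
    by_cases hk2 : k = 1
    · rw [hk2] at hi2 ⊢
      rw [if_pos rfl]
      linarith
    · by_cases hk3 : k < k₀
      · have := renewal_antitone hp hp1 (show 2 ≤ k by omega)
        rw [if_pos hk3]
        linarith
      · have := h k (not_lt.1 hk3)
        linarith
  refine (Finset.sum_le_sum hterm).trans ?_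
  rw [Finset.sum_add_distrib, Finset.sum_add_distrib]
  refine add_le_add (add_le_add ?_ ?_) (by simp)
  · rw [Finset.sum_ite_eq']
    split_ifs <;> simp [ha0]
  · rw [← Finset.sum_filter, Finset.sum_const, nsmul_eq_mul]
    refine mul_le_mul_of_nonneg_right ?_ hc0
    have : (Finset.Ico 1 (m + 1)).filter (fun k => k < k₀) ⊆ Finset.range k₀ :=
      fun k hk => Finset.mem_range.2 (Finset.mem_filter.1 hk).2
    exact_mod_cast (Finset.card_le_card this).trans (Finset.card_range k₀).le

lemma tendsto_sum_renewal {e : ℝ} (he : 0 < e) :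
    Tendsto (fun p : ℝ => ∑ k ∈ Finset.Ico 1 (⌊Real.exp ((b - 2 * e) / p)⌋₊ + 1), renewal p k)
      (𝓝[>] 0) (𝓝 0) := by
  have hb := b_pos
  -- Replacing `b` by `(1 - δ) * (1 - p) * (b - e / 2)` costs at most `e / 4` for `δ`, `e / 4` for
  -- `p` and `e / 2`, so a net exponent of at most `-e / p` remains.
  set δ := min 1 (e / (4 * b)) with hδ
  have hδ0 : 0 < δ := by positivity
  have hδb : δ * b ≤ e / 4 := by
    have := mul_le_mul_of_nonneg_right (min_le_right 1 (e / (4 * b))) hb.le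
    have h2 : e / (4 * b) * b = e / 4 := by field_simp
    linarith
  obtain ⟨C, hC, η, hη, H⟩ := exists_renewal_le (half_pos he) hδ0 (min_le_left _ _)
  have hlim : Tendsto (fun p : ℝ => p * (1 - p)⁻¹ + (C + p) * (2 * p * (1 - p)⁻¹ ^ 3) +
      δ⁻¹ * Real.exp (-(e / p))) (𝓝[>] 0) (𝓝 0) := by
    have hq : Tendsto (fun p : ℝ => (1 - p)⁻¹) (𝓝[>] 0) (𝓝 (1 - 0)⁻¹) :=
      (tendsto_id_nhdsGT.const_sub 1).inv₀ (by norm_num)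
    have := ((tendsto_id_nhdsGT.mul hq).add ((tendsto_id_nhdsGT.const_add C).mul
      ((tendsto_id_nhdsGT.const_mul 2).mul (hq.pow 3)))).add
      ((tendsto_exp_neg_div he).const_mul δ⁻¹)
    simpa using this
  have hη' : ∀ᶠ p : ℝ in 𝓝[>] 0, p * (1 - p)⁻¹ < η := by
    have hq : Tendsto (fun p : ℝ => (1 - p)⁻¹) (𝓝[>] 0) (𝓝 (1 - 0)⁻¹) :=
      (tendsto_id_nhdsGT.const_sub 1).inv₀ (by norm_num)
    exact (tendsto_id_nhdsGT.mul hq).eventually_lt_const (by simpa using hη)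
  refine tendsto_of_tendsto_of_tendsto_of_le_of_le' tendsto_const_nhds hlim ?_ ?_
  · filter_upwards [eventually_pos, eventually_lt one_pos] with p hp hp1
    exact Finset.sum_nonneg fun k _ => renewal_nonneg hp hp1 k
  · filter_upwards [eventually_pos, eventually_lt one_pos, hη',
      eventually_lt (by positivity : 0 < e / (4 * b))] with p hp hp1 hpη hpe
    have hq : 0 < 1 - p := by linarith
    have hpb : p * b ≤ e / 4 := by
      have := mul_le_mul_of_nonneg_right hpe.le hb.le
      have h2 : e / (4 * b) * b = e / 4 := by field_simp
      linarith
    have hk₀ : ∀ k : ℕ, ⌈C / p⌉₊ ≤ k → renewal p k ≤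
        δ⁻¹ * Real.exp (-((1 - δ) * ((1 - p) / p * (b - e / 2)))) := by
      intro k hk
      refine H p hp hp1 (by rw [div_eq_mul_inv]; exact hpη.le) k ?_
      have := Nat.ceil_le.1 hk
      rw [div_le_iff₀ hp] at this
      linarith
    refine (sum_renewal_le_of_le hp hp1 (by positivity) hk₀ _).trans (add_le_add (add_le_add le_rfl
      ?_) ?_)
    · have h1 : (⌈C / p⌉₊ : ℝ) ≤ C / p + 1 := (Nat.ceil_lt_add_one (by positivity)).le
      calc (⌈C / p⌉₊ : ℝ) * (2 * p ^ 2 * (1 - p)⁻¹ ^ 3)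
          ≤ (C / p + 1) * (2 * p ^ 2 * (1 - p)⁻¹ ^ 3) :=
            mul_le_mul_of_nonneg_right h1 (by positivity)
        _ = _ := by field_simp
    · have h1 := Nat.floor_le (Real.exp_pos ((b - 2 * e) / p)).le
      refine (mul_le_mul_of_nonneg_right h1 (by positivity)).trans ?_
      rw [mul_left_comm, ← Real.exp_add]
      refine mul_le_mul_of_nonneg_left (Real.exp_le_exp.2 ?_) (by positivity)
      have h2 : (b - 2 * e) / p + -((1 - δ) * ((1 - p) / p * (b - e / 2))) =
          ((b - 2 * e) - (1 - δ) * (1 - p) * (b - e / 2)) / p := by ring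
      rw [h2, ← neg_div]
      refine div_le_div_of_nonneg_right ?_ hp.le
      have h3 : 1 - δ - p ≤ (1 - δ) * (1 - p) := by nlinarith
      have h4 : (1 - δ) * (1 - p) ≤ 1 := by nlinarith
      nlinarith

lemma tendsto_no_block_bound {e : ℝ} (he : 0 < e) :
    Tendsto (fun p : ℝ => (1 + (⌈Real.exp ((b + e) / p)⌉₊ : ℝ) *
      (Real.exp (-1) * Real.exp (-(b / p))))⁻¹) (𝓝[>] 0) (𝓝 0) := by
  have hlim := (tendsto_exp_neg_div he).const_mul (Real.exp 1)
  rw [mul_zero] at hlim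
  refine squeeze_zero (fun p => by positivity) (fun p => ?_) hlim
  have h1 := mul_le_mul_of_nonneg_right (Nat.le_ceil (Real.exp ((b + e) / p)))
    (by positivity : 0 ≤ Real.exp (-1) * Real.exp (-(b / p)))
  have h2 : Real.exp ((b + e) / p) * (Real.exp (-1) * Real.exp (-(b / p))) =
      (Real.exp 1 * Real.exp (-(e / p)))⁻¹ := by
    rw [← Real.exp_add, ← Real.exp_add, ← Real.exp_add, ← Real.exp_neg]
    congr 1
    ring
  rw [h2] at h1
  exact inv_le_of_inv_le₀ (by positivity) (by linarith)

/-- With `B = exp ((b - 3 * e) / p)` the number of samples is about `e ^ B`, while the power of `1 -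
p` is at most of order `e ^ (-2 * B)`. -/
lemma tendsto_early_bound {e : ℝ} (he : 0 < e) (heb : 3 * e < b) :
    Tendsto (fun p : ℝ => (⌈Real.exp (Real.exp ((b - 3 * e) / p))⌉₊ : ℝ) *
      (1 - p) ^ (⌊Real.exp ((b - 2 * e) / p)⌋₊ + 1 - 1)) (𝓝[>] 0) (𝓝 0) := by
  have hlim := (tendsto_exp_neg_div (sub_pos.2 heb)).const_mul (2 * Real.exp 1)
  rw [mul_zero] at hlim
  refine tendsto_of_tendsto_of_tendsto_of_le_of_le' tendsto_const_nhds hlim ?_ ?_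
  · filter_upwards [eventually_lt one_pos] with p hp1
    have : 0 < 1 - p := by linarith
    positivity
  · filter_upwards [eventually_pos, eventually_lt one_pos, eventually_two_le_mul_exp he]
      with p hp hp1 h2
    rw [Nat.add_sub_cancel]
    set B := Real.exp ((b - 3 * e) / p) with hB
    have hB0 : 0 < B := Real.exp_pos _
    have hBB : Real.exp ((b - 2 * e) / p) = B * Real.exp (e / p) := by
      rw [hB, ← Real.exp_add]
      congr 1
      ring
    have h3 : (⌈Real.exp B⌉₊ : ℝ) ≤ 2 * Real.exp B := by
      have := (Nat.ceil_lt_add_one (Real.exp_pos B).le).le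
      have := Real.one_le_exp hB0.le
      linarith
    have h4 : (1 - p) ^ ⌊Real.exp ((b - 2 * e) / p)⌋₊ ≤
        Real.exp (-(p * ⌊Real.exp ((b - 2 * e) / p)⌋₊)) := by
      have h5 := Real.add_one_le_exp (-p)
      calc _ ≤ Real.exp (-p) ^ ⌊Real.exp ((b - 2 * e) / p)⌋₊ :=
            pow_le_pow_left₀ (by linarith) (by linarith) _
        _ = _ := by rw [← Real.exp_nat_mul]; congr 1; ring
    have h6 : p * Real.exp ((b - 2 * e) / p) - p ≤ p * ⌊Real.exp ((b - 2 * e) / p)⌋₊ := by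
      have := mul_le_mul_of_nonneg_left (Nat.lt_floor_add_one (Real.exp ((b - 2 * e) / p))).le hp.le
      linarith
    have h7 : 2 * B ≤ p * Real.exp ((b - 2 * e) / p) := by
      rw [hBB]
      have := mul_le_mul_of_nonneg_left h2 hB0.le
      linarith
    have h8 : (b - 3 * e) / p ≤ B := by
      have := Real.add_one_le_exp ((b - 3 * e) / p)
      linarith
    calc (⌈Real.exp B⌉₊ : ℝ) * (1 - p) ^ ⌊Real.exp ((b - 2 * e) / p)⌋₊
        ≤ (2 * Real.exp B) * Real.exp (-(p * ⌊Real.exp ((b - 2 * e) / p)⌋₊)) :=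
          mul_le_mul h3 h4 (pow_nonneg (by linarith) _) (by positivity)
      _ = 2 * Real.exp (B - p * ⌊Real.exp ((b - 2 * e) / p)⌋₊) := by
          rw [mul_assoc, ← Real.exp_add, ← sub_eq_add_neg]
      _ ≤ 2 * Real.exp (1 + -((b - 3 * e) / p)) := by
          refine mul_le_mul_of_nonneg_left (Real.exp_le_exp.2 ?_) two_pos.le
          linarith
      _ = _ := by rw [Real.exp_add]; ring

/-- With `B = exp ((b + e) / p)` the power of `1 - p` is at least `e ^ (-4 * p * B)`, while the
number of samples is at least `e ^ (B + 4 * p * B) / 2`. -/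
lemma tendsto_late_bound {e : ℝ} (he : 0 < e) :
    Tendsto (fun p : ℝ => Real.exp (-((⌊Real.exp (Real.exp ((b + 2 * e) / p))⌋₊ : ℝ) *
      (1 - p) ^ ⌈Real.exp ((b + e) / p)⌉₊))) (𝓝[>] 0) (𝓝 0) := by
  have hb := b_pos
  have hlim := tendsto_exp_neg_div (half_pos he)
  refine tendsto_of_tendsto_of_tendsto_of_le_of_le' tendsto_const_nhds hlim
    (Eventually.of_forall fun p => (Real.exp_pos _).le) ?_
  filter_upwards [eventually_pos, eventually_lt (by norm_num : (0 : ℝ) < 1 / 2),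
    eventually_two_le_mul_exp he, eventually_lt he] with p hp hp2 h2 hpe
  have hp1 : p < 1 := by linarith
  have hq : 0 < 1 - p := by linarith
  refine Real.exp_le_exp.2 (neg_le_neg ?_)
  set B := Real.exp ((b + e) / p) with hB
  have hB1 : 1 ≤ B := Real.one_le_exp (by positivity)
  have hBB : Real.exp ((b + 2 * e) / p) = B * Real.exp (e / p) := by
    rw [hB, ← Real.exp_add]
    congr 1
    ring
  have hceil : (⌈B⌉₊ : ℝ) ≤ 2 * B := by
    have := (Nat.ceil_lt_add_one (by linarith : 0 ≤ B)).le
    linarith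
  have hpow : Real.exp (-(2 * p * (2 * B))) ≤ (1 - p) ^ ⌈B⌉₊ := by
    have h3 : p / (1 - p) ≤ 2 * p := by
      rw [div_le_iff₀ hq]
      nlinarith
    have h4 := (lam_le hp1).trans h3
    have h5 : Real.exp (-(2 * p)) ≤ 1 - p := by
      rw [← Real.le_log_iff_exp_le hq]
      linarith
    calc Real.exp (-(2 * p * (2 * B))) ≤ Real.exp (-(2 * p * ⌈B⌉₊)) :=
          Real.exp_le_exp.2 (neg_le_neg (mul_le_mul_of_nonneg_left hceil (by positivity)))
      _ = Real.exp (-(2 * p)) ^ ⌈B⌉₊ := by rw [← Real.exp_nat_mul]; congr 1; ring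
      _ ≤ _ := pow_le_pow_left₀ (Real.exp_pos _).le h5 _
  have h6 : B + 2 * p * (2 * B) ≤ Real.exp ((b + 2 * e) / p) := by
    rw [hBB]
    have h7 : 1 + 4 * p ≤ Real.exp (e / p) := by nlinarith [Real.exp_pos (e / p)]
    have := mul_le_mul_of_nonneg_left h7 (by linarith : 0 ≤ B)
    linarith
  have hfloor : 1 / 2 * Real.exp (Real.exp ((b + 2 * e) / p)) ≤
      ⌊Real.exp (Real.exp ((b + 2 * e) / p))⌋₊ := by
    have h8 := Real.add_one_le_exp (Real.exp ((b + 2 * e) / p))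
    have h9 : 1 ≤ Real.exp ((b + 2 * e) / p) := Real.one_le_exp (by positivity)
    have := (Nat.lt_floor_add_one (Real.exp (Real.exp ((b + 2 * e) / p)))).le
    linarith
  calc e / 2 / p ≤ 1 / 2 * Real.exp B := by
        have h8 := Real.add_one_le_exp B
        have h9 := Real.add_one_le_exp ((b + e) / p)
        have h10 : (b + e) / p = b / p + e / p := add_div _ _ _
        have h11 : 0 < b / p := by positivity
        have h12 : e / 2 / p = 1 / 2 * (e / p) := by ring
        rw [h12]
        linarith
    _ = 1 / 2 * Real.exp (B + 2 * p * (2 * B)) * Real.exp (-(2 * p * (2 * B))) := by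
        rw [mul_assoc, ← Real.exp_add]
        congr 2
        ring
    _ ≤ 1 / 2 * Real.exp (Real.exp ((b + 2 * e) / p)) * (1 - p) ^ ⌈B⌉₊ :=
        mul_le_mul (mul_le_mul_of_nonneg_left (Real.exp_le_exp.2 h6) (by norm_num)) hpow
          (Real.exp_pos _).le (by positivity)
    _ ≤ _ := mul_le_mul_of_nonneg_right hfloor (by positivity)

lemma abs_mul_log_log_sub_lt {p c d ε : ℝ} (hp : 0 < p) (hc : 0 ≤ c) (hcb : b - ε < c)
    (hdb : d < b + ε) {n : ℕ} (h1 : ⌈Real.exp (Real.exp (c / p))⌉₊ ≤ n)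
    (h2 : n ≤ ⌊Real.exp (Real.exp (d / p))⌋₊) :
    2 ≤ n ∧ |p * Real.log (Real.log n) - b| < ε := by
  have h3 : Real.exp (Real.exp (c / p)) ≤ n := Nat.ceil_le.1 h1
  have h4 : (n : ℝ) ≤ Real.exp (Real.exp (d / p)) := (Nat.le_floor_iff (Real.exp_pos _).le).1 h2
  have hc1 : 1 ≤ Real.exp (c / p) := Real.one_le_exp (by positivity)
  have h5 : (2 : ℝ) ≤ n := by linarith [Real.add_one_le_exp (Real.exp (c / p))]
  have hn : (0 : ℝ) < n := by linarith
  refine ⟨by exact_mod_cast h5, ?_⟩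
  have h6 : Real.exp (c / p) ≤ Real.log n := (Real.le_log_iff_exp_le hn).2 h3
  have h7 : Real.log n ≤ Real.exp (d / p) := (Real.log_le_iff_le_exp hn).2 h4
  have hl : 0 < Real.log n := by linarith
  have h8 : c / p ≤ Real.log (Real.log n) := (Real.le_log_iff_exp_le hl).2 h6
  have h9 : Real.log (Real.log n) ≤ d / p := (Real.log_le_iff_le_exp hl).2 h7
  rw [div_le_iff₀ hp] at h8
  rw [le_div_iff₀ hp] at h9
  rw [abs_lt]
  constructor <;> linarith

end Rainstick

theorem theorem3 {Ω : ℝ → Type*} [∀ p, MeasurableSpace (Ω p)]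
    (P : ∀ p, Measure (Ω p)) [∀ p, IsProbabilityMeasure (P p)]
    (X : ∀ p, ℕ → Ω p → ℕ)
    (hmeas : ∀ p, 0 < p → p < 1 → ∀ i, Measurable (X p i))
    (hindep : ∀ p, 0 < p → p < 1 → iIndepFun (X p) (P p))
    (hgeo : ∀ p, 0 < p → p < 1 → ∀ i j : ℕ, 1 ≤ j →
      P p {ω | X p i ω = j} = ENNReal.ofReal (p * (1 - p) ^ (j - 1))) :
    ∀ ε : ℝ, 0 < ε →
      Tendsto (fun p : ℝ => P p {ω | ∃ n : ℕ,
          Rainstick.numSamples (fun i => X p i ω) = (n : ℕ∞) ∧ 2 ≤ n ∧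
          |p * Real.log (Real.log (n : ℝ)) - Rainstick.b| < ε})
        (𝓝[>] (0 : ℝ)) (𝓝 1) := by
  intro ε hε
  have hb := Rainstick.b_pos
  -- The window for `p log log N` is `[b - 3 * e, b + 2 * e]`. It must fit within `ε` of `b`, and
  -- its lower end must be nonnegative so that `n ≥ 2`.
  set e := min ε Rainstick.b / 4 with he_def
  have he : 0 < e := by positivity
  have heε : 3 * e < ε := by have := min_le_left ε Rainstick.b; linarith
  have heb : 3 * e < Rainstick.b := by have := min_le_right ε Rainstick.b; linarith
  have hlim := (((ENNReal.tendsto_ofReal (Rainstick.tendsto_sum_renewal he)).add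
    (ENNReal.tendsto_ofReal (Rainstick.tendsto_no_block_bound he))).add
    (ENNReal.tendsto_ofReal (Rainstick.tendsto_early_bound he heb))).add
    (ENNReal.tendsto_ofReal (Rainstick.tendsto_late_bound he))
  simp only [ENNReal.ofReal_zero, add_zero] at hlim
  have hlim' := ENNReal.Tendsto.sub (tendsto_const_nhds (x := (1 : ENNReal))) hlim
    (Or.inl ENNReal.one_ne_top)
  rw [tsub_zero] at hlim'
  refine tendsto_of_tendsto_of_tendsto_of_le_of_le' hlim' tendsto_const_nhds ?_
    (Eventually.of_forall fun p => prob_le_one)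
  filter_upwards [Rainstick.eventually_pos, Rainstick.eventually_lt one_pos] with p hp hp1
  have hG : Rainstick.IsGeometric (P p) p (X p) :=
    ⟨hp, hp1, hmeas p hp hp1, hindep p hp hp1, hgeo p hp hp1⟩
  rw [tsub_le_iff_right]
  refine (hG.one_le_measure_add (Nat.succ_pos _)).trans (add_le_add (measure_mono ?_) le_rfl)
  rintro ω ⟨n, h1, h2, h3⟩
  exact ⟨n, h3, Rainstick.abs_mul_log_log_sub_lt hp (by linarith) (by linarith) (by linarith) h1 h2⟩
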